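/- There exists a Hausdorff locally compact topological group $G$ with the following properties: 1. $G$ is simple as an abstract group, i.e. $G \neq \{1\}$ and its only normal subgroups (closed or not) are $\{1\}$ and $G$; 2. $G$ is compactly generated, i.e. $G$ has a compact generating set; 3. $G$ has asymptotic dimension one, i.e. for every compact generating set $S$ of $G$, the metric space $(G, d_S)$ has asymptotic dimension exactly $1$, where $d_S(g,h)$ is the least number of factors needed to write $g^{-1}h$ as a product of elements of $S \cup S^{-1}$; 4. $G$ has no lattices, i.e. there is no discrete subgroup $\Gamma \le G$ such that $G/\Gamma$ carries a non-zero finite $G$-invariant regular Borel measure. Here a metric space $X$ has asymptotic dimension at most $n$ if for every $r > 0$ there are $n+1$ families of subsets of $X$, whose union covers $X$, such that in each family the diameters of the members are bounded by a common constant and any two distinct members $A, B$ satisfy $d(a,b) \ge r$ for all $a \in A$, $b \in B$. The asymptotic dimension of $X$ is the smallest integer $n \geq 0$ with this property (and $\infty$ if there is none). -/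

import Mathlib

open MeasureTheory

/-- A family of subsets of a metric space is uniformly bounded if the diameters of its members
are bounded by a common constant. -/
def UniformlyBoundedFamily {X : Type*} [PseudoMetricSpace X] (U : Set (Set X)) : Prop :=
  ∃ C : ℝ, ∀ A ∈ U, ∀ x ∈ A, ∀ y ∈ A, dist x y ≤ C

/-- The members of the family `U` are pairwise `r`-disjoint: any two distinct members are at
distance at least `r` from each other. -/
def RDisjointFamily {X : Type*} [PseudoMetricSpace X] (r : ℝ) (U : Set (Set X)) : Prop :=
  U.Pairwise fun A B => ∀ a ∈ A, ∀ b ∈ B, r ≤ dist a b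

/-- `X` has asymptotic dimension at most `n`: for every `r > 0` there are `n + 1` uniformly bounded
families of pairwise `r`-disjoint sets whose union covers `X`. -/
def AsymptoticDimensionLE (X : Type*) [PseudoMetricSpace X] (n : ℕ) : Prop :=
  ∀ r : ℝ, 0 < r → ∃ U : Fin (n + 1) → Set (Set X),
    (∀ i, UniformlyBoundedFamily (U i)) ∧ (∀ i, RDisjointFamily r (U i)) ∧
      ∀ x : X, ∃ i, ∃ A ∈ U i, x ∈ A

/-- The asymptotic dimension of `X`: the smallest `n` such that `X` has asymptotic dimension at
most `n`, and `⊤` if there is no such `n`. -/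
noncomputable def asymptoticDimension (X : Type*) [PseudoMetricSpace X] : ℕ∞ :=
  sInf {m : ℕ∞ | ∃ n : ℕ, m = n ∧ AsymptoticDimensionLE X n}

/-- `g` is a product of `n` elements of `S ∪ S⁻¹`. -/
def IsWordOfLength {G : Type*} [Group G] (S : Set G) (g : G) (n : ℕ) : Prop :=
  ∃ l : List G, l.length = n ∧ (∀ x ∈ l, x ∈ S ∨ x⁻¹ ∈ S) ∧ l.prod = g

/-- The word length of `g` with respect to `S` (meaningful when `S` generates the group). -/
noncomputable def wordLength {G : Type*} [Group G] (S : Set G) (g : G) : ℕ :=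
  sInf {n : ℕ | IsWordOfLength S g n}

theorem exists_isWordOfLength {G : Type*} [Group G] {S : Set G}
    (hS : Subgroup.closure S = ⊤) (g : G) : ∃ n, IsWordOfLength S g n := by
  have hg : g ∈ (Subgroup.closure S).toSubmonoid := by simp [hS]
  rw [Subgroup.closure_toSubmonoid] at hg
  obtain ⟨l, hl, rfl⟩ := Submonoid.exists_list_of_mem_closure hg
  exact ⟨_, l, rfl, hl, rfl⟩

theorem isWordOfLength_wordLength {G : Type*} [Group G] {S : Set G}
    (hS : Subgroup.closure S = ⊤) (g : G) : IsWordOfLength S g (wordLength S g) :=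
  Nat.sInf_mem (exists_isWordOfLength hS g)

theorem IsWordOfLength.wordLength_le {G : Type*} [Group G] {S : Set G} {g : G} {n : ℕ}
    (h : IsWordOfLength S g n) : wordLength S g ≤ n :=
  Nat.sInf_le h

theorem wordLength_one {G : Type*} [Group G] (S : Set G) : wordLength S 1 = 0 :=
  Nat.le_zero.1 (IsWordOfLength.wordLength_le ⟨[], rfl, by simp, rfl⟩)

theorem eq_one_of_wordLength_eq_zero {G : Type*} [Group G] {S : Set G}
    (hS : Subgroup.closure S = ⊤) {g : G} (h : wordLength S g = 0) : g = 1 := by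
  obtain ⟨l, hl, -, rfl⟩ := isWordOfLength_wordLength hS g
  rw [h] at hl
  simp [List.length_eq_zero_iff.1 hl]

theorem wordLength_inv_le {G : Type*} [Group G] {S : Set G}
    (hS : Subgroup.closure S = ⊤) (g : G) : wordLength S g⁻¹ ≤ wordLength S g := by
  obtain ⟨l, hl, hl', hg⟩ := isWordOfLength_wordLength hS g
  refine IsWordOfLength.wordLength_le
    ⟨(l.map fun x => x⁻¹).reverse, by simpa using hl, fun x hx => ?_, ?_⟩
  · rw [List.mem_reverse, List.mem_map] at hx
    obtain ⟨y, hy, rfl⟩ := hx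
    simpa using (hl' y hy).symm
  · rw [← hg, List.prod_inv_reverse]

theorem wordLength_mul_le {G : Type*} [Group G] {S : Set G}
    (hS : Subgroup.closure S = ⊤) (g h : G) :
    wordLength S (g * h) ≤ wordLength S g + wordLength S h := by
  obtain ⟨l, hl, hl', hg⟩ := isWordOfLength_wordLength hS g
  obtain ⟨k, hk, hk', hh⟩ := isWordOfLength_wordLength hS h
  refine IsWordOfLength.wordLength_le ⟨l ++ k, by simp [hl, hk], fun x hx => ?_, by simp [hg, hh]⟩
  rcases List.mem_append.1 hx with hx | hx
  · exact hl' x hx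
  · exact hk' x hx

/-- The (left-invariant) word metric `d(g, h) = |g⁻¹h|` of a group with respect to a generating
set `S`. It is a metric on the underlying set of the group, in general unrelated to a topology
that the group may carry. -/
@[reducible]
noncomputable def wordMetricSpace {G : Type*} [Group G] (S : Set G)
    (hS : Subgroup.closure S = ⊤) : MetricSpace G where
  dist g h := (wordLength S (g⁻¹ * h) : ℝ)
  dist_self g := by simp [wordLength_one]
  dist_comm g h := by
    have key : ∀ a b : G, wordLength S (a⁻¹ * b) ≤ wordLength S (b⁻¹ * a) := fun a b => by
      simpa using wordLength_inv_le hS (b⁻¹ * a)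
    exact congrArg Nat.cast (le_antisymm (key g h) (key h g))
  dist_triangle g h k := by
    have := wordLength_mul_le hS (g⁻¹ * h) (h⁻¹ * k)
    rw [mul_assoc, mul_inv_cancel_left] at this
    exact_mod_cast this
  eq_of_dist_eq_zero {g h} H :=
    inv_mul_eq_one.1 (eq_one_of_wordLength_eq_zero hS (Nat.cast_eq_zero.1 H))

/-- A topological group is compactly generated if it has a compact generating set. -/
def IsCompactlyGeneratedGroup (G : Type*) [Group G] [TopologicalSpace G] : Prop :=
  ∃ S : Set G, IsCompact S ∧ Subgroup.closure S = ⊤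

/-- The compactly generated locally compact group `G` has asymptotic dimension `n`. Word metrics of
compact generating sets of such a group are pairwise quasi-isometric, so that one may use any of
them. -/
def HasAsymptoticDimension (G : Type*) [Group G] [TopologicalSpace G] (n : ℕ∞) : Prop :=
  IsCompactlyGeneratedGroup G ∧
    ∀ (S : Set G) (_ : IsCompact S) (hS : Subgroup.closure S = ⊤),
      @asymptoticDimension G (wordMetricSpace S hS).toPseudoMetricSpace = n

/-- A subgroup `Γ` of `G` is a lattice if it is discrete and the space `G ⧸ Γ` of left cosets
carries a non-zero finite regular Borel measure that is invariant under left translation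
by `G`. -/
def IsLattice {G : Type*} [Group G] [TopologicalSpace G] (Γ : Subgroup G) : Prop :=
  DiscreteTopology Γ ∧
    letI : MeasurableSpace (G ⧸ Γ) := borel (G ⧸ Γ)
    ∃ μ : Measure (G ⧸ Γ), μ ≠ 0 ∧ IsFiniteMeasure μ ∧ μ.Regular ∧ SMulInvariantMeasure G (G ⧸ Γ) μ

/-! Let `A` be the alternating group on five letters and `B` a subgroup of order two. In the regular
tree with edges properly coloured by `A`, take the automorphisms acting on the colours at each
vertex by x ↦ p x q⁻¹. Both ends of an edge must give it the same new colour, and left translations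
are simply transitive, so p at a vertex follows from p at a neighbour and the two values of q. An
automorphism thus amounts to the image of the root, the p there, and a completely free assignment of
q (`exists_portrait`). The group `almost B` asks that q lie in `B` outside finitely many vertices,
the singularities, and that the bipartition be preserved. In its topology the elements that fix the
root and have no singularities form a compact open subgroup.

Simplicity: a nontrivial normal subgroup contains some t mapping a half-tree deep into itself
(`exists_shrinking`). An element supported on a suitable smaller half-tree is a commutator of t with
an infinite product of conjugates by powers of t; this product lies in the group because forward
orbits leave the finite singular set of t (`mem_of_shrinking`). Hence all nonsingular elements
supported on half-trees are obtained. Their local actions at a vertex, together with simplicity of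
`A`, yield the vertex groups (`vertexGroup_le_of_normal`), which generate.

Asymptotic dimension: the root stabilizer is an increasing union of compact open subgroups, hence of
dimension zero, and so are finite unions of its cosets. Cutting the tree into annuli and colouring
them by parity gives the bound one; the dimension is not zero because word lengths are unbounded.

Lattices: comparing covolumes, a lattice would meet the group of elements living on a sphere of M
vertices in a subgroup of A^M of index at most C·2^b, where b is the size of the ball. As b is at
most 1.1 M and 4^1.1 < 5, while proper subgroups of `A` have index at least 5, this subgroup
contains a whole factor `A` (`exists_mulSingle_mem`). The factor's elements in `B` are nonsingular
and close to the identity, against discreteness. -/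

/-! ### The regular tree -/

/-- The vertices of the regular tree whose edges are properly coloured by `Ω`: words without two
equal consecutive letters, the head of the list being the letter farthest from the root. -/
def ColorTree (Ω : Type) : Type := {l : List Ω // l.IsChain (· ≠ ·)}

namespace ColorTree

variable {Ω : Type}

/-- The base vertex. -/
def root : ColorTree Ω := ⟨[], List.isChain_nil⟩

/-- The distance to the base vertex. -/
def depth (v : ColorTree Ω) : ℕ := v.1.length

open Classical in
/-- The neighbour of a vertex across its edge of colour `x`. -/
noncomputable def step (x : Ω) : ColorTree Ω → ColorTree Ω
  | ⟨[], _⟩ => ⟨[x], List.isChain_singleton x⟩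
  | ⟨y :: l, h⟩ => if hxy : x = y then ⟨l, h.tail⟩
      else ⟨x :: y :: l, List.isChain_cons_cons.2 ⟨hxy, h⟩⟩

theorem step_cons_self (x : Ω) (l : List Ω) (h : (x :: l).IsChain (· ≠ ·)) :
    step x ⟨x :: l, h⟩ = ⟨l, h.tail⟩ := by
  simp [step]; rfl

theorem step_eq_cons (x : Ω) (l : List Ω) (h : (x :: l).IsChain (· ≠ ·)) :
    step x ⟨l, h.tail⟩ = ⟨x :: l, h⟩ := by
  cases l with
  | nil => rfl
  | cons y l =>
    have hxy : x ≠ y := (List.isChain_cons_cons.1 h).1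
    simp [step, hxy]; rfl

theorem step_cases (x : Ω) (v : ColorTree Ω) :
    (∃ l h, v = ⟨x :: l, h⟩) ∨ ∃ h : (x :: v.1).IsChain (· ≠ ·), step x v = ⟨x :: v.1, h⟩ := by
  rcases v with ⟨_ | ⟨y, l⟩, h⟩
  · exact Or.inr ⟨List.isChain_singleton x, rfl⟩
  · by_cases hxy : x = y
    · subst hxy; exact Or.inl ⟨l, h, rfl⟩
    · exact Or.inr ⟨List.isChain_cons_cons.2 ⟨hxy, h⟩, by simp [step, hxy]; rfl⟩

@[simp] theorem step_step (x : Ω) (v : ColorTree Ω) : step x (step x v) = v := by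
  rcases step_cases x v with ⟨l, h, rfl⟩ | ⟨h, e⟩
  · rw [step_cons_self, step_eq_cons x l h]
  · rw [e, step_cons_self]; rfl

theorem induction_step {P : ColorTree Ω → Prop} (h0 : P root)
    (hs : ∀ x v, depth (step x v) = depth v + 1 → P v → P (step x v)) (v : ColorTree Ω) : P v := by
  rcases v with ⟨l, h⟩
  induction l with
  | nil => exact h0
  | cons x l ih =>
    rw [← step_eq_cons x l h]
    exact hs x _ (by rw [step_eq_cons x l h]; rfl) (ih h.tail)

theorem depth_step (x : Ω) (v : ColorTree Ω) :
    depth (step x v) = depth v + 1 ∨ depth v = depth (step x v) + 1 := by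
  rcases step_cases x v with ⟨l, h, rfl⟩ | ⟨h, e⟩
  · right; rw [step_cons_self]; rfl
  · left; rw [e]; rfl

@[simp] theorem depth_root : depth (root : ColorTree Ω) = 0 := rfl

theorem depth_eq_zero {v : ColorTree Ω} (h : depth v = 0) : v = root :=
  Subtype.ext (List.length_eq_zero_iff.1 h)

theorem exists_depth_step {v : ColorTree Ω} (h : v ≠ root) :
    ∃ x, depth (step x v) < depth v := by
  rcases v with ⟨_ | ⟨x, l⟩, hv⟩
  · exact absurd rfl h
  · exact ⟨x, by rw [step_cons_self]; exact Nat.lt_succ_self _⟩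

theorem eq_of_depth_step {x y : Ω} {v : ColorTree Ω} (hx : depth (step x v) < depth v)
    (hy : depth (step y v) < depth v) : x = y := by
  rcases step_cases x v with ⟨l, h, rfl⟩ | ⟨h, e⟩
  · rcases step_cases y ⟨x :: l, h⟩ with ⟨l', h', e⟩ | ⟨h', e⟩
    · exact (List.cons.inj (Subtype.ext_iff.1 e)).1
    · rw [e] at hy; exact absurd hy (by simp [depth])
  · rw [e] at hx; exact absurd hx (by simp [depth])

/-- Transport a state along the word `v`. -/
def run {X : Type} (ι : Ω → X → X) (x₀ : X) (v : ColorTree Ω) : X := v.1.foldr ι x₀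

/-- Since each transition is an involution, backtracking over an edge restores the state. This turns
recursion on words into recursion along all edges. -/
theorem run_step {X : Type} {ι : Ω → X → X} (hι : ∀ x s, ι x (ι x s) = s) (x₀ : X) (x : Ω)
    (v : ColorTree Ω) : run ι x₀ (step x v) = ι x (run ι x₀ v) := by
  rcases step_cases x v with ⟨l, h, rfl⟩ | ⟨h, e⟩
  · rw [step_cons_self]; exact (hι x _).symm
  · rw [e]; rfl

theorem eq_of_step {X : Type} {ι : Ω → X → X} {f g : ColorTree Ω → X} (h0 : f root = g root)
    (hf : ∀ x v, f (step x v) = ι x (f v)) (hg : ∀ x v, g (step x v) = ι x (g v)) : f = g := by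
  funext v
  induction v using induction_step with
  | h0 => exact h0
  | hs x v _ ih => rw [hf, hg, ih]

/-- A nonempty set of vertices that is closed under passing to neighbours is everything. -/
theorem mem_of_step_closed {P : ColorTree Ω → Prop} (hs : ∀ x v, P v → P (step x v))
    {u : ColorTree Ω} (hu : P u) (v : ColorTree Ω) : P v := by
  have h0 : P root := by
    induction u using induction_step with
    | h0 => exact hu
    | hs x v _ ih => exact ih (by simpa using hs x _ hu)
  induction v using induction_step with
  | h0 => exact h0
  | hs x v _ ih => exact hs x v ih

/-- Left translation by the word `u`. -/
noncomputable def shift (u : ColorTree Ω) : ColorTree Ω → ColorTree Ω := run step u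

theorem shift_step (u : ColorTree Ω) (x : Ω) (v : ColorTree Ω) :
    shift u (step x v) = step x (shift u v) := run_step step_step u x v

theorem shift_root (u : ColorTree Ω) : shift u root = u := rfl

theorem shift_surjective (u : ColorTree Ω) : Function.Surjective (shift u) := by
  refine mem_of_step_closed ?_ ⟨root, shift_root u⟩
  rintro x _ ⟨v, rfl⟩
  exact ⟨step x v, shift_step u x v⟩

/-- If the shift by `u` sends `v` to the root, its composite with the shift by `v` commutes with all
steps and fixes the root, so it is the identity. -/
theorem shift_bijective (u : ColorTree Ω) : Function.Bijective (shift u) := by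
  obtain ⟨v, hv⟩ := shift_surjective u root
  have huv : ∀ w, shift u (shift v w) = w := fun w => by
    have := eq_of_step (f := fun w => shift u (shift v w)) (g := id) (ι := step) hv
      (fun x w => by simp [shift_step]) (fun x w => rfl)
    exact congrFun this w
  refine ⟨fun a b hab => ?_, shift_surjective u⟩
  obtain ⟨a, rfl⟩ := shift_surjective v a
  obtain ⟨b, rfl⟩ := shift_surjective v b
  rw [huv, huv] at hab
  rw [hab]

/-- Left translation as a permutation of the vertices. -/
noncomputable def shiftEquiv (u : ColorTree Ω) : Equiv.Perm (ColorTree Ω) :=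
  Equiv.ofBijective _ (shift_bijective u)

theorem shiftEquiv_symm_step (u : ColorTree Ω) (x : Ω) (v : ColorTree Ω) :
    (shiftEquiv u).symm (step x v) = step x ((shiftEquiv u).symm v) := by
  rw [Equiv.symm_apply_eq]
  change _ = shift u _
  rw [shift_step]
  exact congrArg _ ((shiftEquiv u).apply_symm_apply v).symm

theorem shiftEquiv_symm_self (u : ColorTree Ω) : (shiftEquiv u).symm u = root := by
  rw [Equiv.symm_apply_eq]; rfl

/-- The graph distance between two vertices. -/
noncomputable def gap (u v : ColorTree Ω) : ℕ := depth ((shiftEquiv u).symm v)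

@[simp] theorem gap_self (u : ColorTree Ω) : gap u u = 0 := by
  rw [gap, shiftEquiv_symm_self]; rfl

theorem eq_of_gap_eq_zero {u v : ColorTree Ω} (h : gap u v = 0) : u = v := by
  have := depth_eq_zero h
  rw [Equiv.symm_apply_eq] at this
  exact this.symm

theorem gap_step (u : ColorTree Ω) (x : Ω) (v : ColorTree Ω) :
    gap u (step x v) = gap u v + 1 ∨ gap u v = gap u (step x v) + 1 := by
  simp only [gap, shiftEquiv_symm_step]
  exact depth_step x _

theorem exists_gap_step {u v : ColorTree Ω} (h : u ≠ v) :
    ∃ x, gap u v = gap u (step x v) + 1 := by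
  obtain ⟨x, hx⟩ := exists_depth_step (v := (shiftEquiv u).symm v) fun e => by
    rw [Equiv.symm_apply_eq] at e; exact h e.symm
  rw [← shiftEquiv_symm_step] at hx
  change gap u (step x v) < gap u v at hx
  exact ⟨x, by rcases gap_step u x v with h | h <;> omega⟩

theorem eq_of_gap_step {x y : Ω} {u v : ColorTree Ω} (hx : gap u (step x v) < gap u v)
    (hy : gap u (step y v) < gap u v) : x = y := by
  simp only [gap, shiftEquiv_symm_step] at hx hy
  exact eq_of_depth_step hx hy

theorem gap_root (v : ColorTree Ω) : gap root v = depth v := by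
  have := eq_of_step (f := shift (root : ColorTree Ω)) (g := id) (ι := step) rfl
    (shift_step _) (fun _ _ => rfl)
  rw [gap]
  congr 1
  rw [Equiv.symm_apply_eq]
  exact (congrFun this v).symm

theorem gap_triangle (a b c : ColorTree Ω) : gap a c ≤ gap a b + gap b c := by
  induction h : gap b c generalizing c with
  | zero => rw [eq_of_gap_eq_zero h]; simp
  | succ n ih =>
    obtain ⟨x, hx⟩ := exists_gap_step (u := b) (v := c) (by rintro rfl; simp at h)
    have := ih (step x c) (by omega)
    have := gap_step a x c
    omega

theorem gap_comm_le (a b : ColorTree Ω) : gap b a ≤ gap a b := by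
  induction h : gap a b generalizing b with
  | zero => rw [eq_of_gap_eq_zero h]; simp
  | succ n ih =>
    obtain ⟨x, hx⟩ := exists_gap_step (u := a) (v := b) (by rintro rfl; simp at h)
    have h1 := ih (step x b) (by omega)
    have h2 := gap_triangle b (step x b) a
    have h3 := gap_step b x b
    simp at h3
    omega

theorem gap_comm (a b : ColorTree Ω) : gap a b = gap b a :=
  le_antisymm (gap_comm_le b a) (gap_comm_le a b)

theorem gap_step_self (x : Ω) (v : ColorTree Ω) : gap v (step x v) = 1 := by
  have := gap_step v x v
  simp at this
  exact this

theorem step_ne (x : Ω) (v : ColorTree Ω) : step x v ≠ v := fun h => by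
  have := gap_step_self x v
  rw [h] at this
  simp at this

theorem step_injective_left {x y : Ω} {v : ColorTree Ω} (h : step x v = step y v) : x = y :=
  eq_of_gap_step (u := step x v) (v := v) (by
    rw [gap_self, gap_comm, gap_step_self]; exact one_pos)
    (by rw [← h, gap_self, gap_comm, gap_step_self]; exact one_pos)

theorem exists_step_of_gap_eq_one {u v : ColorTree Ω} (h : gap u v = 1) : ∃ x, v = step x u := by
  obtain ⟨x, hx⟩ := exists_gap_step (u := u) (v := v) (by rintro rfl; simp at h)
  refine ⟨x, ?_⟩
  have : u = step x v := eq_of_gap_eq_zero (by omega)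
  rw [this, step_step]

/-- The parity of the distance of two vertices is determined by their depths. -/
theorem gap_parity (u v : ColorTree Ω) : (gap u v + depth u + depth v) % 2 = 0 := by
  refine mem_of_step_closed (P := fun v => (gap u v + depth u + depth v) % 2 = 0)
    (fun x v hv => ?_) (u := u) (by simp; omega) v
  have := gap_step u x v
  have := depth_step x v
  omega

theorem finite_depth_le [Finite Ω] (n : ℕ) : {v : ColorTree Ω | depth v ≤ n}.Finite := by
  refine Set.Finite.of_finite_image (f := Subtype.val) ?_ Subtype.val_injective.injOn
  refine (List.finite_length_le Ω n).subset ?_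
  rintro _ ⟨v, hv, rfl⟩
  exact hv

/-- A local isomorphism of the tree preserves distances. -/
theorem gap_map {f : ColorTree Ω → ColorTree Ω} {s : ColorTree Ω → Ω → Ω}
    (hs : ∀ v, Function.Injective (s v)) (hf : ∀ x v, f (step x v) = step (s v x) (f v))
    (u v : ColorTree Ω) : gap (f u) (f v) = gap u v := by
  induction h : gap u v using Nat.strong_induction_on generalizing v with
  | _ n ih =>
    by_cases huv : u = v
    · subst huv; simp at h; simp [h]
    obtain ⟨x, hx⟩ := exists_gap_step huv
    have h1 := ih _ (by omega) (step x v) rfl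
    by_cases hu : u = step x v
    · have hv : v = step x u := by rw [hu, step_step]
      rw [hv, hf, gap_step_self, ← h, hv, gap_step_self]
    obtain ⟨y, hy⟩ := exists_gap_step hu
    have h2 := ih _ (by omega) (step y (step x v)) rfl
    have h3 := gap_step (f u) (s (step x v) x) (f (step x v))
    rw [← hf, step_step] at h3
    rcases h3 with h3 | h3
    · omega
    -- Here two colours at `f (step x v)` lead towards `f u`; they coincide, and injectivity of the
    -- local action contradicts the choice of `y`.
    · exfalso
      have := eq_of_gap_step (u := f u) (v := f (step x v)) (x := s (step x v) x)
        (y := s (step x v) y) (by rw [← hf, step_step]; omega) (by rw [← hf]; omega)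
      have := hs _ this
      subst this
      rw [step_step] at hy
      omega

/-- The half-tree of the vertices seen from `u` through the edge of colour `x`. -/
def branch (u : ColorTree Ω) (x : Ω) : Set (ColorTree Ω) := {v | gap v (step x u) < gap v u}

theorem mem_branch {u v : ColorTree Ω} {x : Ω} :
    v ∈ branch u x ↔ gap v (step x u) < gap v u := Iff.rfl

theorem not_mem_branch_self (u : ColorTree Ω) (x : Ω) : u ∉ branch u x := by
  simp [mem_branch]

theorem step_mem_branch (u : ColorTree Ω) (x : Ω) : step x u ∈ branch u x := by
  rw [mem_branch, gap_self, gap_comm, gap_step_self]; exact one_pos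

theorem branch_unique {u v : ColorTree Ω} {x y : Ω} (hx : v ∈ branch u x) (hy : v ∈ branch u y) :
    x = y := eq_of_gap_step hx hy

theorem exists_mem_branch {u v : ColorTree Ω} (h : v ≠ u) : ∃ x, v ∈ branch u x := by
  obtain ⟨x, hx⟩ := exists_gap_step h
  exact ⟨x, by rw [mem_branch]; omega⟩

/-- The complement of a half-tree is a half-tree. -/
theorem mem_branch_step {u v : ColorTree Ω} {x : Ω} :
    v ∈ branch (step x u) x ↔ v ∉ branch u x := by
  have := gap_step v x u
  rw [mem_branch, mem_branch, step_step]
  omega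

theorem branch_subset {u : ColorTree Ω} {x y : Ω} (h : y ≠ x) :
    branch (step x u) y ⊆ branch u x := fun v hv => by
  by_contra hn
  exact h (branch_unique hv (mem_branch_step.2 hn))

/-- Away from the base `step x u`, the colour leading towards the base also leads towards `u`, so
one step cannot reverse the comparison of the two distances. -/
theorem step_mem_branch_of_ne {u v : ColorTree Ω} {x y : Ω} (hv : v ∈ branch u x)
    (h : step y v ∉ branch u x) : v = step x u ∧ y = x := by
  have h0 : gap (step y v) u < gap (step y v) (step x u) := by
    have := gap_step (step y v) x u
    rw [mem_branch] at h; omega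
  have h1 := gap_step u y v
  have h2 := gap_step (step x u) y v
  rw [gap_comm u, gap_comm u] at h1
  rw [gap_comm _ (step y v), gap_comm _ v] at h2
  have h3 := gap_step v x u
  have h4 := gap_step (step y v) x u
  rw [mem_branch] at hv
  by_cases hvx : v = step x u
  · refine ⟨hvx, ?_⟩
    subst hvx
    by_contra hne
    exact h (branch_subset hne (step_mem_branch _ _))
  · exfalso
    obtain ⟨z, hz⟩ := exists_gap_step (Ne.symm hvx)
    have h5 := gap_step u z v
    have h6 := gap_triangle u (step x u) (step z v)
    rw [gap_step_self] at h6
    rw [gap_comm (step x u) v] at hz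
    have hyz : y = z := eq_of_gap_step (u := u) (v := v)
      (by rw [gap_comm, gap_comm u v]; omega) (by rw [gap_comm u v] at *; omega)
    subst hyz
    rw [gap_comm (step x u)] at hz
    omega

/-- Entering a half-tree passes through its base vertex. -/
theorem gap_of_mem_branch {u b w : ColorTree Ω} {y : Ω} (hu : u ∉ branch b y)
    (hw : w ∈ branch b y) : gap u w = gap u b + gap b w := by
  have key : ∀ n, ∀ u, u ∉ branch b y → gap b u = n → gap w u = gap b u + gap w b := by
    intro n
    induction n with
    | zero => intro u _ h; rw [← eq_of_gap_eq_zero h]; simp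
    | succ n ih =>
      intro u hu h
      obtain ⟨z, hz⟩ := exists_gap_step (u := b) (v := u) (by rintro rfl; simp at h)
      have hu1 : step z u ∉ branch b y := fun hm => by
        obtain ⟨h1, rfl⟩ := step_mem_branch_of_ne (y := z) hm (by rwa [step_step])
        have hub : u = b := by rw [← step_step z u, h1, step_step]
        subst hub
        simp at h
      have h1 := ih (step z u) hu1 (by omega)
      rcases gap_step w z u with h2 | h2
      · exfalso
        have h3 : gap w (step z (step z u)) < gap w (step z u) := by rw [step_step]; omega
        by_cases hb : b = step z u
        · have : z = y := by
            refine eq_of_gap_step h3 ?_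
            rw [← hb]; exact hw
          subst this
          have : u = step z b := by rw [hb, step_step]
          exact hu (this ▸ step_mem_branch _ _)
        · obtain ⟨z', hz'⟩ := exists_gap_step hb
          have hne : z' = z := by
            refine eq_of_gap_step (u := w) ?_ h3
            have := gap_triangle w b (step z' (step z u))
            omega
          subst hne
          rw [step_step] at hz'
          omega
      · omega
  have := key _ u hu rfl
  rw [gap_comm u w, this, gap_comm b u, gap_comm w b]

/-- Half-trees facing away from each other are disjoint. -/
theorem disjoint_branch {u u' : ColorTree Ω} {x y : Ω} (hne : u ≠ u') (h : u' ∉ branch u x)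
    (h' : u ∉ branch u' y) {v : ColorTree Ω} (hv : v ∈ branch u x) : v ∉ branch u' y := fun hv' => by
  have h1 := gap_of_mem_branch h hv
  have h2 := gap_of_mem_branch h' hv'
  rw [gap_comm u u'] at h2
  exact hne (eq_of_gap_eq_zero (by rw [gap_comm]; omega))

end ColorTree

/-! ### Tree automorphisms with local action by left and right translations -/

open ColorTree

section Twist

variable {A : Type} [Group A]

/-- The action of `A × A` on `A` by left and right translations. -/
def twist (s : A × A) (x : A) : A := s.1 * x * s.2⁻¹

theorem twist_mul (s t : A × A) (x : A) : twist (s * t) x = twist s (twist t x) := by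
  simp [twist, mul_assoc]

@[simp] theorem twist_one (x : A) : twist 1 x = x := by simp [twist]

@[simp] theorem twist_inv_twist (s : A × A) (x : A) : twist s⁻¹ (twist s x) = x := by
  rw [← twist_mul]; simp

@[simp] theorem twist_twist_inv (s : A × A) (x : A) : twist s (twist s⁻¹ x) = x := by
  rw [← twist_mul]; simp

theorem twist_injective (s : A × A) : Function.Injective (twist s) :=
  Function.LeftInverse.injective (twist_inv_twist s)

/-- Evaluating at 1 makes the two components equal; the action is then conjugation, and the centre
is trivial. -/
theorem eq_one_of_twist (hZ : ∀ a : A, (∀ x, a * x = x * a) → a = 1) {s : A × A}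
    (h : ∀ x, twist s x = x) : s = 1 := by
  have h1 : s.1 = s.2 := by
    have := h 1
    simp only [twist, mul_one] at this
    rwa [mul_inv_eq_one] at this
  have h2 : s.2 = 1 := hZ _ fun x => by
    have := h x
    rwa [twist, h1, mul_inv_eq_iff_eq_mul] at this
  exact Prod.ext (h1.trans h2) h2

end Twist

/-- An automorphism of the tree `ColorTree A` together with its local actions, which are required
to be given by left and right translations of `A`. -/
@[ext] structure LocalAut (A : Type) [Group A] where
  /-- the permutation of the vertices -/
  toPerm : Equiv.Perm (ColorTree A)
  /-- the local actions -/
  loc : ColorTree A → A × A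
  map_step' : ∀ x v, toPerm (step x v) = step (twist (loc v) x) (toPerm v)

namespace LocalAut

variable {A : Type} [Group A]

instance : Mul (LocalAut A) where
  mul g h :=
    { toPerm := g.toPerm * h.toPerm
      loc := fun v => g.loc (h.toPerm v) * h.loc v
      map_step' := fun x v => by
        simp [h.map_step', g.map_step', twist_mul] }

instance : One (LocalAut A) where
  one := { toPerm := 1, loc := fun _ => 1, map_step' := fun x v => by simp }

instance : Inv (LocalAut A) where
  inv g :=
    { toPerm := g.toPerm.symm
      loc := fun v => (g.loc (g.toPerm.symm v))⁻¹
      map_step' := fun x v => by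
        rw [Equiv.symm_apply_eq, g.map_step', twist_twist_inv, Equiv.apply_symm_apply] }

instance : Group (LocalAut A) where
  mul_assoc a b c := LocalAut.ext rfl (funext fun v => mul_assoc _ _ _)
  one_mul a := LocalAut.ext rfl (funext fun v => one_mul _)
  mul_one a := LocalAut.ext rfl (funext fun v => mul_one _)
  inv_mul_cancel a := LocalAut.ext (inv_mul_cancel a.toPerm) (funext fun v => by
    change (a.loc (a.toPerm.symm (a.toPerm v)))⁻¹ * a.loc v = 1
    simp)

instance : MulAction (LocalAut A) (ColorTree A) where
  smul g v := g.toPerm v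
  one_smul _ := rfl
  mul_smul _ _ _ := rfl

theorem loc_mul (g h : LocalAut A) (v : ColorTree A) :
    (g * h).loc v = g.loc (h • v) * h.loc v := rfl

@[simp] theorem loc_one (v : ColorTree A) : (1 : LocalAut A).loc v = 1 := rfl

theorem loc_inv (g : LocalAut A) (v : ColorTree A) : g⁻¹.loc v = (g.loc (g⁻¹ • v))⁻¹ := rfl

theorem smul_step (g : LocalAut A) (x : A) (v : ColorTree A) :
    g • step x v = step (twist (g.loc v) x) (g • v) := g.map_step' x v

theorem ext_smul {g h : LocalAut A} (h1 : ∀ v : ColorTree A, g • v = h • v)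
    (h2 : ∀ v, g.loc v = h.loc v) : g = h :=
  LocalAut.ext (Equiv.ext h1) (funext h2)

theorem eq_one_of_smul (hZ : ∀ a : A, (∀ x, a * x = x * a) → a = 1) {g : LocalAut A}
    (h : ∀ v : ColorTree A, g • v = v) : g = 1 := by
  refine ext_smul (fun v => by rw [h v, one_smul]) fun v => eq_one_of_twist hZ fun x => ?_
  have := g.smul_step x v
  rw [h, h] at this
  exact (step_injective_left this).symm

theorem eq_of_smul (hZ : ∀ a : A, (∀ x, a * x = x * a) → a = 1) {g h : LocalAut A}
    (H : ∀ v : ColorTree A, g • v = h • v) : g = h := by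
  rw [← inv_mul_eq_one]
  exact eq_one_of_smul hZ fun v => by rw [mul_smul, ← H, inv_smul_smul]

theorem gap_smul (g : LocalAut A) (u v : ColorTree A) : gap (g • u) (g • v) = gap u v :=
  gap_map (fun v => twist_injective (g.loc v)) (fun x v => g.smul_step x v) u v

theorem smul_mem_branch (g : LocalAut A) {u v : ColorTree A} {x : A} :
    g • v ∈ branch (g • u) (twist (g.loc u) x) ↔ v ∈ branch u x := by
  rw [mem_branch, mem_branch, ← smul_step, gap_smul, gap_smul]

theorem parity_smul (g : LocalAut A) {u : ColorTree A} (hu : (depth (g • u) + depth u) % 2 = 0)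
    (v : ColorTree A) : (depth (g • v) + depth v) % 2 = 0 := by
  have h1 := gap_parity u v
  have h2 := gap_parity (g • u) (g • v)
  rw [gap_smul] at h2
  omega

theorem twist_loc_step (g : LocalAut A) (x : A) (v : ColorTree A) :
    twist (g.loc (step x v)) x = twist (g.loc v) x := by
  have := g.smul_step x (step x v)
  rw [step_step, smul_step] at this
  exact (step_injective_left (v := step (twist (g.loc v) x) (g • v))
    (by rw [← this, step_step])).symm

/-- The common new colour of an edge determines the first component at one end from the second
component there and the local action at the other end. This is why only second components are free.
-/
theorem loc_step_fst (g : LocalAut A) (x : A) (v : ColorTree A) :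
    (g.loc (step x v)).1 = twist (g.loc v) x * (g.loc (step x v)).2 * x⁻¹ := by
  rw [← twist_loc_step, twist]; group

/-- Two automorphisms agree near a vertex: same image and same local action. -/
def AgreeAt (g h : LocalAut A) (v : ColorTree A) : Prop := g • v = h • v ∧ g.loc v = h.loc v

theorem AgreeAt.step {g h : LocalAut A} {v : ColorTree A} (H : AgreeAt g h v) {x : A}
    (hx : (g.loc (step x v)).2 = (h.loc (step x v)).2) : AgreeAt g h (step x v) :=
  ⟨by rw [smul_step, smul_step, H.1, H.2],
    Prod.ext (by rw [loc_step_fst, loc_step_fst, H.2, hx]) hx⟩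

/-- Automorphisms that agree at the base of a half-tree and have the same second components of
the local actions in that half-tree agree on it. -/
theorem AgreeAt.branch {g h : LocalAut A} {u : ColorTree A} {x : A}
    (H : AgreeAt g h (ColorTree.step x u))
    (hq : ∀ v ∈ ColorTree.branch u x, (g.loc v).2 = (h.loc v).2) {v : ColorTree A}
    (hv : v ∈ ColorTree.branch u x) : AgreeAt g h v := by
  induction hn : gap (ColorTree.step x u) v generalizing v with
  | zero => rwa [← eq_of_gap_eq_zero hn]
  | succ n ih =>
    obtain ⟨y, hy⟩ := exists_gap_step (u := ColorTree.step x u) (v := v)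
      (by rintro rfl; simp at hn)
    have hm : ColorTree.step y v ∈ ColorTree.branch u x := by
      by_contra hne
      obtain ⟨rfl, rfl⟩ := step_mem_branch_of_ne hv hne
      simp at hn
    have := (ih hm (by omega)).step (x := y)
    rw [step_step] at this
    exact this (hq v hv)

theorem AgreeAt.ball {g h : LocalAut A} (H : g • (root : ColorTree A) = h • root)
    (Hp : (g.loc root).1 = (h.loc root).1) {n : ℕ}
    (hq : ∀ v, depth v ≤ n → (g.loc v).2 = (h.loc v).2) {v : ColorTree A} (hv : depth v ≤ n) :
    AgreeAt g h v := by
  induction v using induction_step with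
  | h0 => exact ⟨H, Prod.ext Hp (hq _ (Nat.zero_le _))⟩
  | hs x v hd ih => exact (ih (by omega)).step (hq _ hv)

/-- The second components of the local actions can be prescribed arbitrarily. -/
theorem exists_portrait (u₀ : ColorTree A) (p₀ : A) (Q : ColorTree A → A) :
    ∃ g : LocalAut A, g • (root : ColorTree A) = u₀ ∧ (g.loc root).1 = p₀ ∧
      ∀ v, (g.loc v).2 = Q v := by
  -- The state consists of the current vertex, its image, and the first component of the local
  -- action; the latter evolves as forced by `loc_step_fst`.
  let ι : A → ColorTree A × ColorTree A × A → ColorTree A × ColorTree A × A := fun x s =>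
    (step x s.1, step (s.2.2 * x * (Q s.1)⁻¹) s.2.1,
      s.2.2 * x * (Q s.1)⁻¹ * Q (step x s.1) * x⁻¹)
  have hι : ∀ x s, ι x (ι x s) = s := by
    rintro x ⟨w, u, p⟩
    have : p * x * (Q w)⁻¹ * Q (step x w) * x⁻¹ * x * (Q (step x w))⁻¹ = p * x * (Q w)⁻¹ := by
      group
    refine Prod.ext (by simp [ι]) (Prod.ext ?_ ?_)
    · simp only [ι, this, step_step]
    · simp only [ι, this, step_step]; group
  let r : ColorTree A → ColorTree A × ColorTree A × A := run ι (root, u₀, p₀)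
  have hr : ∀ x v, r (step x v) = ι x (r v) := fun x v => run_step hι _ x v
  have hr1 : ∀ v, (r v).1 = v := fun v => by
    induction v using induction_step with
    | h0 => rfl
    | hs x v _ ih => rw [hr]; simp only [ι, ih]
  let f : ColorTree A → ColorTree A := fun v => (r v).2.1
  let s : ColorTree A → A × A := fun v => ((r v).2.2, Q v)
  have hf : ∀ x v, f (step x v) = step (twist (s v) x) (f v) := fun x v => by
    simp only [f, s, hr, ι, hr1, twist]
  have hbij : Function.Bijective f := by
    refine ⟨fun a b hab => ?_, mem_of_step_closed (u := u₀) ?_ ⟨root, rfl⟩⟩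
    · have := gap_map (fun v => twist_injective (s v)) hf a b
      rw [hab, gap_self] at this
      exact eq_of_gap_eq_zero this.symm
    · rintro x _ ⟨v, rfl⟩
      exact ⟨step (twist (s v)⁻¹ x) v, by rw [hf, twist_twist_inv]⟩
  exact ⟨⟨Equiv.ofBijective f hbij, s, hf⟩, rfl, rfl, fun v => rfl⟩

theorem loc_eq_of_snd_eq_one {g : LocalAut A} (hq : ∀ v, (g.loc v).2 = 1) (u v : ColorTree A) :
    g.loc v = g.loc u := by
  refine mem_of_step_closed (P := fun v => g.loc v = g.loc u) (fun x v hv => ?_) (u := u) rfl v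
  refine Prod.ext ?_ ((hq _).trans (hq _).symm)
  rw [loc_step_fst, twist, hq, hq, hv]
  group

/-- An automorphism `t` with trivial local actions carries the root to `u`, so the construction at
the root can be transported. -/
theorem exists_portrait_at (u u₀ : ColorTree A) (p₀ : A) (Q : ColorTree A → A) :
    ∃ g : LocalAut A, g • u = u₀ ∧ (g.loc u).1 = p₀ ∧ ∀ v, (g.loc v).2 = Q v := by
  obtain ⟨t, ht, htp, htq⟩ := exists_portrait u 1 fun _ => (1 : A)
  have ht1 : ∀ v, t.loc v = 1 := fun v => by
    rw [loc_eq_of_snd_eq_one htq root v]; exact Prod.ext htp (htq _)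
  obtain ⟨g, hg, hgp, hgq⟩ := exists_portrait u₀ p₀ fun v => Q (t • v)
  have hti : t⁻¹ • u = root := by rw [inv_smul_eq_iff, ht]
  have hl : ∀ v, (g * t⁻¹).loc v = g.loc (t⁻¹ • v) := fun v => by
    rw [loc_mul, loc_inv, ht1]; simp
  refine ⟨g * t⁻¹, by rw [mul_smul, hti, hg], by rw [hl, hti, hgp], fun v => ?_⟩
  rw [hl, hgq, smul_inv_smul]

/-- Automorphisms with constant local action are transitive on pairs of a vertex and a colour. -/
theorem exists_const (u u' : ColorTree A) (p : A) :
    ∃ g : LocalAut A, g • u = u' ∧ ∀ v, g.loc v = (p, 1) := by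
  obtain ⟨g, hg, hp, hq⟩ := exists_portrait_at u u' p fun _ => (1 : A)
  exact ⟨g, hg, fun v => by rw [loc_eq_of_snd_eq_one hq u v]; exact Prod.ext hp (hq _)⟩

/-- Automorphisms supported on pairwise disjoint sets can be put together. -/
theorem exists_glue {ι : Type} (D : ι → Set (ColorTree A)) (f : ι → LocalAut A)
    (hD : ∀ i j v, v ∈ D i → v ∈ D j → i = j)
    (hf : ∀ i, ∀ v ∉ D i, AgreeAt (f i) 1 v) :
    ∃ g : LocalAut A, (∀ i, ∀ v ∈ D i, AgreeAt g (f i) v) ∧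
      ∀ v, (∀ i, v ∉ D i) → AgreeAt g 1 v := by
  classical
  have hmaps : ∀ i v, v ∈ D i → f i • v ∈ D i := fun i v hv => by
    by_contra hn
    have h1 := (hf i _ hn).1
    rw [one_smul] at h1
    exact hn ((smul_left_cancel _ h1).symm ▸ hv)
  let c : ColorTree A → LocalAut A := fun v => if h : ∃ i, v ∈ D i then f h.choose else 1
  have hc : ∀ i v, v ∈ D i → c v = f i := fun i v hv => by
    have h : ∃ i, v ∈ D i := ⟨i, hv⟩
    simp only [c, dif_pos h]
    rw [hD _ _ v h.choose_spec hv]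
  have hc' : ∀ v, (∀ i, v ∉ D i) → c v = 1 := fun v hv => by
    have h : ¬ ∃ i, v ∈ D i := fun ⟨i, hi⟩ => hv i hi
    simp only [c, dif_neg h]
  -- Compatibility across edges. When an edge enters `D j`, the automorphism `f j` is trivial at the
  -- outer end together with its local action, hence fixes the inner end too.
  have hcc : ∀ x v, c (step x v) • step x v = c v • step x v := fun x v => by
    by_cases hw : ∃ j, step x v ∈ D j
    · obtain ⟨j, hj⟩ := hw
      by_cases hv : v ∈ D j
      · rw [hc j _ hj, hc j _ hv]
      · have e : c (step x v) • step x v = step x v := by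
          rw [hc j _ hj, smul_step, (hf j v hv).1, (hf j v hv).2]; simp
        rw [e]
        by_cases hv' : ∃ i, v ∈ D i
        · obtain ⟨i, hi⟩ := hv'
          have hne : step x v ∉ D i := fun h => hv (hD _ _ _ h hj ▸ hi)
          rw [hc i _ hi, (hf i _ hne).1, one_smul]
        · rw [hc' v (by simpa using hv'), one_smul]
    · have hw' : ∀ j, step x v ∉ D j := by simpa using hw
      rw [hc' _ hw', one_smul]
      by_cases hv' : ∃ i, v ∈ D i
      · obtain ⟨i, hi⟩ := hv'
        rw [hc i _ hi, (hf i _ (hw' i)).1, one_smul]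
      · rw [hc' v (by simpa using hv'), one_smul]
  have hbij : Function.Bijective fun v => c v • v := by
    have hstep : ∀ x v, c (step x v) • step x v = step (twist ((c v).loc v) x) (c v • v) :=
      fun x v => by rw [hcc, smul_step]
    refine ⟨fun a b hab => ?_, fun w => ?_⟩
    · have := gap_map (f := fun v => c v • v) (fun v => twist_injective ((c v).loc v)) hstep a b
      simp only at hab
      rw [hab, gap_self] at this
      exact eq_of_gap_eq_zero this.symm
    · refine mem_of_step_closed (P := fun w => ∃ v, c v • v = w) ?_ (u := c root • root)
        ⟨root, rfl⟩ w
      rintro x _ ⟨v, rfl⟩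
      exact ⟨step (twist ((c v).loc v)⁻¹ x) v, by rw [hstep, twist_twist_inv]⟩
  refine ⟨⟨Equiv.ofBijective _ hbij, fun v => (c v).loc v, fun x v => ?_⟩, fun i v hv => ?_,
    fun v hv => ?_⟩
  · change c (step x v) • step x v = _
    rw [hcc, smul_step]; rfl
  · exact ⟨by rw [← hc i v hv]; rfl, by rw [← hc i v hv]⟩
  · exact ⟨by rw [← hc' v hv]; rfl, by rw [← hc' v hv]⟩

end LocalAut

open LocalAut

/-! ### The group of automorphisms with almost prescribed local action -/

namespace LocalAut

variable {A : Type} [Group A]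

theorem depth_smul {g : LocalAut A} (hg : g • (root : ColorTree A) = root) (v : ColorTree A) :
    depth (g • v) = depth v := by
  rw [← gap_root, ← gap_root v, ← gap_smul g root v, hg]

theorem depth_smul_le (g : LocalAut A) (v : ColorTree A) :
    depth (g • v) ≤ depth (g • (root : ColorTree A)) + depth v := by
  have := gap_triangle root (g • (root : ColorTree A)) (g • v)
  rwa [gap_smul, gap_root, gap_root, gap_root] at this

theorem smul_root_of_inv {g : LocalAut A} (hg : g • (root : ColorTree A) = root) :
    g⁻¹ • (root : ColorTree A) = root := by rw [inv_smul_eq_iff, hg]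

/-- The tree automorphisms that preserve the parity of the depth and whose local actions have
second component in `B` at all but finitely many vertices. -/
def almost (B : Subgroup A) : Subgroup (LocalAut A) where
  carrier := {g | {v | (g.loc v).2 ∉ B}.Finite ∧
    ∀ v : ColorTree A, (depth (g • v) + depth v) % 2 = 0}
  one_mem' := ⟨by simp [B.one_mem], fun v => by rw [one_smul]; omega⟩
  mul_mem' {g h} hg hh := by
    refine ⟨?_, fun v => ?_⟩
    · refine (hh.1.union (hg.1.preimage (f := fun v => h • v)
        (MulAction.injective h).injOn)).subset fun v hv => ?_
      by_contra hn
      simp only [Set.mem_union, Set.mem_preimage, Set.mem_ofPred_eq, not_or, not_not] at hn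
      exact hv (B.mul_mem hn.2 hn.1)
    · have h1 := hh.2 v
      have h2 := hg.2 (h • v)
      rw [mul_smul]; omega
  inv_mem' {g} hg := by
    refine ⟨?_, fun v => ?_⟩
    · refine (hg.1.preimage (f := fun v => g⁻¹ • v) (MulAction.injective g⁻¹).injOn).subset
        fun v hv hn => hv ?_
      rw [loc_inv]
      exact B.inv_mem hn
    · have := hg.2 (g⁻¹ • v)
      rw [smul_inv_smul] at this
      omega

end LocalAut

/-! ### Neighbourhoods of the identity and the group topology -/

namespace LocalAut.almost

variable {A : Type} [Group A] {B : Subgroup A}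

theorem mem_of_root {g : LocalAut A} (hg : g • (root : ColorTree A) = root)
    (hB : {v | (g.loc v).2 ∉ B}.Finite) : g ∈ almost B :=
  ⟨hB, fun v => by rw [depth_smul hg]; omega⟩

theorem mem_of_fix {g : LocalAut A} {u : ColorTree A} (hg : g • u = u)
    (hB : {v | (g.loc v).2 ∉ B}.Finite) : g ∈ almost B :=
  ⟨hB, parity_smul g (u := u) (by rw [hg]; omega)⟩

theorem mul_snd_mem {g h : LocalAut A} {v : ColorTree A} (hg : (g.loc (h • v)).2 ∈ B)
    (hh : (h.loc v).2 ∈ B) : ((g * h).loc v).2 ∈ B := B.mul_mem hg hh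

theorem inv_snd_mem {g : LocalAut A} {v : ColorTree A} (hg : (g.loc (g⁻¹ • v)).2 ∈ B) :
    ((g⁻¹).loc v).2 ∈ B := B.inv_mem hg

variable (B)

/-- The basic neighbourhoods of the identity. -/
def level (k : ℕ) : Subgroup (almost B) where
  carrier := {g | (g : LocalAut A) • (root : ColorTree A) = root ∧
    (∀ v, depth v ≤ k → (g : LocalAut A).loc v = 1) ∧ ∀ v, ((g : LocalAut A).loc v).2 ∈ B}
  one_mem' := ⟨one_smul _ _, fun v _ => rfl, fun v => B.one_mem⟩
  mul_mem' {g h} hg hh :=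
    ⟨by rw [Subgroup.coe_mul, mul_smul, hh.1, hg.1], fun v hv => by
      rw [Subgroup.coe_mul, loc_mul, hh.2.1 v hv, hg.2.1 _ (by rwa [depth_smul hh.1]), mul_one],
      fun v => mul_snd_mem (hg.2.2 _) (hh.2.2 _)⟩
  inv_mem' {g} hg :=
    ⟨smul_root_of_inv hg.1, fun v hv => by
      rw [Subgroup.coe_inv, loc_inv, hg.2.1 _ (by rwa [depth_smul (smul_root_of_inv hg.1)]),
        inv_one], fun v => inv_snd_mem (hg.2.2 _)⟩

/-- The elements fixing the root without singularities at depth more than `n`. -/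
def ellip (n : ℕ) : Subgroup (almost B) where
  carrier := {g | (g : LocalAut A) • (root : ColorTree A) = root ∧
    ∀ v, n < depth v → ((g : LocalAut A).loc v).2 ∈ B}
  one_mem' := ⟨one_smul _ _, fun v _ => B.one_mem⟩
  mul_mem' {g h} hg hh :=
    ⟨by rw [Subgroup.coe_mul, mul_smul, hh.1, hg.1], fun v hv =>
      mul_snd_mem (hg.2 _ (by rwa [depth_smul hh.1])) (hh.2 _ hv)⟩
  inv_mem' {g} hg :=
    ⟨smul_root_of_inv hg.1, fun v hv =>
      inv_snd_mem (hg.2 _ (by rwa [depth_smul (smul_root_of_inv hg.1)]))⟩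

variable {B}

theorem level_anti {k l : ℕ} (h : k ≤ l) : level B l ≤ level B k := fun _ hg =>
  ⟨hg.1, fun v hv => hg.2.1 v (hv.trans h), hg.2.2⟩

theorem ellip_mono {k l : ℕ} (h : k ≤ l) : ellip B k ≤ ellip B l := fun _ hg =>
  ⟨hg.1, fun v hv => hg.2 v (h.trans_lt hv)⟩

theorem level_le_ellip (k n : ℕ) : level B k ≤ ellip B n := fun _ hg =>
  ⟨hg.1, fun v _ => hg.2.2 v⟩

theorem smul_of_loc_eq_one {g : LocalAut A} {n : ℕ} (h0 : g • (root : ColorTree A) = root)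
    (h1 : ∀ v, depth v ≤ n → g.loc v = 1) {v : ColorTree A} (hv : depth v ≤ n) : g • v = v := by
  have := (AgreeAt.ball (g := g) (h := 1) (by rw [h0, one_smul])
    (by rw [h1 _ (Nat.zero_le _), loc_one]) (n := n) (fun v hv => by rw [h1 v hv, loc_one]) hv).1
  rwa [one_smul] at this

theorem smul_of_mem_level {g : almost B} {k : ℕ} (hg : g ∈ level B k) {v : ColorTree A}
    (hv : depth v ≤ k) : (g : LocalAut A) • v = v := smul_of_loc_eq_one hg.1 hg.2.1 hv

theorem exists_depth_singular_le [Finite A] (g : almost B) :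
    ∃ n, ∀ v, n < depth v → ((g : LocalAut A).loc v).2 ∈ B := by
  obtain ⟨n, hn⟩ := (g.2.1.image depth).bddAbove
  exact ⟨n, fun v hv => by
    by_contra hb
    exact absurd (hn ⟨v, hb, rfl⟩) (by omega)⟩

/-- If `u` is trivial on a large enough ball, the conjugate is trivial both on the ball of radius
`k` and wherever `g` could introduce singularities. -/
theorem exists_level_conj [Finite A] (g : almost B) (k : ℕ) :
    ∃ m, ∀ u ∈ level B m, g * u * g⁻¹ ∈ level B k := by
  obtain ⟨n, hn⟩ := exists_depth_singular_le g
  let g' : LocalAut A := g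
  -- The radius covers the singularities of `g`, of depth at most `n`, and the preimage under `g` of
  -- the ball of radius `k`.
  refine ⟨n + k + depth (g'⁻¹ • (root : ColorTree A)), fun u hu => ?_⟩
  have key : ∀ v, depth (g'⁻¹ • v) ≤ n + k + depth (g'⁻¹ • (root : ColorTree A)) →
      (g' * u * g'⁻¹) • v = v ∧ (g' * u * g'⁻¹).loc v = 1 := fun v hv => by
    have h1 := smul_of_mem_level hu hv
    refine ⟨by rw [mul_smul, mul_smul, h1, smul_inv_smul], ?_⟩
    rw [loc_mul, loc_mul, h1, hu.2.1 _ hv, loc_inv, mul_one, mul_inv_cancel]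
  refine ⟨(key root (by omega)).1, fun v hv => (key v ?_).2, fun v => ?_⟩
  · have := depth_smul_le g'⁻¹ v
    omega
  · by_cases hv : depth (g'⁻¹ • v) ≤ n + k + depth (g'⁻¹ • (root : ColorTree A))
    · change ((g' * u * g'⁻¹).loc v).2 ∈ B
      rw [(key v hv).2]; exact B.one_mem
    · have h1 : n < depth (g'⁻¹ • v) := by omega
      refine mul_snd_mem (mul_snd_mem (hn _ ?_) (hu.2.2 _)) (inv_snd_mem (hn _ h1))
      rw [Subgroup.coe_inv, depth_smul hu.1]
      exact h1

section Topology

variable [Finite A] (B)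

/-- The group topology on `almost B`. -/
@[reducible] def filterBasis : GroupFilterBasis (almost B) where
  sets := Set.range fun k => (level B k : Set (almost B))
  nonempty := ⟨_, 0, rfl⟩
  inter_sets := by
    rintro _ _ ⟨k, rfl⟩ ⟨l, rfl⟩
    exact ⟨_, ⟨max k l, rfl⟩, fun g hg =>
      ⟨level_anti (le_max_left k l) hg, level_anti (le_max_right k l) hg⟩⟩
  one' := by rintro _ ⟨k, rfl⟩; exact (level B k).one_mem
  mul' := by
    rintro _ ⟨k, rfl⟩
    refine ⟨_, ⟨k, rfl⟩, ?_⟩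
    rintro _ ⟨g, hg, h, hh, rfl⟩
    exact (level B k).mul_mem hg hh
  inv' := by
    rintro _ ⟨k, rfl⟩
    exact ⟨_, ⟨k, rfl⟩, fun g hg => (level B k).inv_mem hg⟩
  conj' := by
    rintro g _ ⟨k, rfl⟩
    obtain ⟨m, hm⟩ := exists_level_conj g k
    exact ⟨_, ⟨m, rfl⟩, hm⟩

instance : TopologicalSpace (almost B) := (filterBasis B).topology

instance : IsTopologicalGroup (almost B) := (filterBasis B).isTopologicalGroup

variable {B}

theorem mem_nhds_iff {g : almost B} {s : Set (almost B)} :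
    s ∈ nhds g ↔ ∃ k, ∀ u ∈ level B k, g * u ∈ s := by
  rw [((filterBasis B).nhds_hasBasis g).mem_iff]
  constructor
  · rintro ⟨_, ⟨k, rfl⟩, hk⟩
    exact ⟨k, fun u hu => hk ⟨u, hu, rfl⟩⟩
  · rintro ⟨k, hk⟩
    refine ⟨_, ⟨k, rfl⟩, ?_⟩
    rintro _ ⟨u, hu, rfl⟩
    exact hk u hu

theorem isOpen_level (k : ℕ) : IsOpen (level B k : Set (almost B)) :=
  (level B k).isOpen_of_mem_nhds (g := 1) (mem_nhds_iff.2 ⟨k, fun u hu => by simpa using hu⟩)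

theorem isOpen_ellip (n : ℕ) : IsOpen (ellip B n : Set (almost B)) :=
  Subgroup.isOpen_mono (level_le_ellip 0 n) (isOpen_level 0)

instance : T2Space (almost B) := by
  refine IsTopologicalGroup.t2Space_of_one_sep fun g hg => ?_
  by_contra H
  push Not at H
  have hk : ∀ k, g ∈ level B k := fun k => H _ ((isOpen_level k).mem_nhds (level B k).one_mem)
  refine hg (Subtype.ext (ext_smul (fun v => ?_) fun v => ?_))
  · rw [smul_of_mem_level (hk _) le_rfl, Subgroup.coe_one, one_smul]
  · exact (hk _).2.1 v le_rfl

/-- Along an ultrafilter every local datum is eventually constant because `A` is finite, and the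
free choice of portraits realizes the limiting data by an automorphism. -/
theorem isCompact_ellip (n : ℕ) : IsCompact (ellip B n : Set (almost B)) := by
  rw [isCompact_iff_ultrafilter_le_nhds]
  intro F hF
  have hlim : ∀ f : almost B → A, ∃ a, ∀ᶠ g in F, f g = a := fun f => by
    obtain ⟨a, ha⟩ := (F.map f).eq_pure_of_finite
    exact ⟨a, by
      have : ∀ᶠ b in (F.map f : Filter A), b = a := by rw [ha]; simp
      exact this⟩
  have hF' : ∀ᶠ g in F, g ∈ ellip B n := Filter.le_principal_iff.1 hF
  choose Q hQ using fun v : ColorTree A => hlim fun g => ((g : LocalAut A).loc v).2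
  obtain ⟨p, hp⟩ := hlim fun g => ((g : LocalAut A).loc root).1
  obtain ⟨g, hg0, hgp, hgQ⟩ := exists_portrait root p Q
  have hgB : ∀ v, n < depth v → (g.loc v).2 ∈ B := fun v hv => by
    obtain ⟨h, h1, h2⟩ := ((hQ v).and hF').exists
    rw [hgQ, ← h1]
    exact h2.2 v hv
  have hgm : g ∈ almost B := mem_of_root hg0 ((finite_depth_le n).subset fun v hv => by
    by_contra hn
    simp only [Set.mem_ofPred_eq, not_le] at hn
    exact hv (hgB v hn))
  refine ⟨⟨g, hgm⟩, ⟨hg0, hgB⟩, fun s hs => ?_⟩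
  obtain ⟨k, hk⟩ := mem_nhds_iff.1 hs
  -- Agreement up to depth `n + k`, not only `k`, makes the quotient trivial where singularities may
  -- occur; beyond depth `n` both elements have second components in `B`.
  have hfin : ∀ᶠ h : almost B in F, ∀ v ∈ {v : ColorTree A | depth v ≤ n + k},
      ((h : LocalAut A).loc v).2 = Q v :=
    (Filter.eventually_all_finite (finite_depth_le _)).2 fun v _ => hQ v
  filter_upwards [hfin, hp, hF'] with h h1 h2 h3
  have hagree : ∀ v, depth v ≤ n + k → AgreeAt (h : LocalAut A) g v := fun v hv =>
    AgreeAt.ball (by rw [h3.1, hg0]) (by rw [h2, hgp])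
      (fun v hv => by rw [h1 v hv, hgQ]) hv
  have hloc : ∀ v, depth v ≤ n + k → (g⁻¹ * (h : LocalAut A)).loc v = 1 := fun v hv => by
    rw [loc_mul, loc_inv, (hagree v hv).1, inv_smul_smul, (hagree v hv).2, inv_mul_cancel]
  have hroot : (g⁻¹ * (h : LocalAut A)) • (root : ColorTree A) = root := by
    rw [mul_smul, h3.1, smul_root_of_inv hg0]
  have := hk ((⟨g, hgm⟩ : almost B)⁻¹ * h) ⟨hroot, fun v hv => hloc v (by omega), fun v => by
    by_cases hv : depth v ≤ n + k
    · change ((g⁻¹ * (h : LocalAut A)).loc v).2 ∈ B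
      rw [hloc v hv]; exact B.one_mem
    · refine mul_snd_mem (inv_snd_mem (hgB _ ?_)) (h3.2 v (by omega))
      rw [depth_smul (smul_root_of_inv hg0), depth_smul h3.1]; omega⟩
  rwa [mul_inv_cancel_left] at this

instance : LocallyCompactSpace (almost B) :=
  (isCompact_ellip 0).locallyCompactSpace_of_mem_nhds_of_group
    ((isOpen_ellip 0).mem_nhds (ellip B 0).one_mem)

/-- Elements of a compact set displace the root by a bounded amount. -/
theorem exists_depth_smul_root_le {K : Set (almost B)} (hK : IsCompact K) :
    ∃ n, ∀ g ∈ K, depth ((g : LocalAut A) • (root : ColorTree A)) ≤ n := by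
  have hcont : Continuous fun g : almost B => depth ((g : LocalAut A) • (root : ColorTree A)) := by
    rw [continuous_iff_continuousAt]
    intro g
    refine tendsto_nhds.2 fun s _ hs => mem_nhds_iff.2 ⟨0, fun u hu => ?_⟩
    change depth (((g : LocalAut A) * (u : LocalAut A)) • (root : ColorTree A)) ∈ s
    rw [mul_smul, hu.1]
    exact hs
  obtain ⟨n, hn⟩ := (hK.image hcont).bddAbove
  exact ⟨n, fun g hg => hn ⟨g, hg, rfl⟩⟩

/-- The stabilizer of the root is locally elliptic. -/
theorem exists_subset_ellip {K : Set (almost B)} (hK : IsCompact K)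
    (h : ∀ g ∈ K, (g : LocalAut A) • (root : ColorTree A) = root) : ∃ n, K ⊆ ellip B n := by
  obtain ⟨n, hn⟩ := hK.elim_directed_cover (fun n => (ellip B n : Set (almost B)))
    (fun n => isOpen_ellip n) (fun g hg => by
      obtain ⟨n, hn⟩ := exists_depth_singular_le g
      exact Set.mem_iUnion.2 ⟨n, h g hg, hn⟩)
    (directed_of_isDirected_le fun k l hkl => ellip_mono hkl)
  exact ⟨n, hn⟩

end Topology

end LocalAut.almost

/-! ### Generation -/

namespace LocalAut.almost

variable {A : Type} [Group A] {B : Subgroup A}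

variable (B) in
/-- The elements fixing the vertex `u` without singularities outside `u`. -/
def vertexGroup (u : ColorTree A) : Subgroup (almost B) where
  carrier := {g | (g : LocalAut A) • u = u ∧ ∀ v, v ≠ u → ((g : LocalAut A).loc v).2 ∈ B}
  one_mem' := ⟨one_smul _ _, fun v _ => B.one_mem⟩
  mul_mem' {g h} hg hh :=
    ⟨by rw [Subgroup.coe_mul, mul_smul, hh.1, hg.1], fun v hv =>
      mul_snd_mem (hg.2 _ fun e => hv (smul_left_cancel (h : LocalAut A) (e.trans hh.1.symm)))
        (hh.2 _ hv)⟩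
  inv_mem' {g} hg :=
    ⟨by rw [Subgroup.coe_inv, inv_smul_eq_iff, hg.1], fun v hv =>
      inv_snd_mem (hg.2 _ fun e => hv (by rwa [inv_smul_eq_iff, hg.1] at e))⟩

theorem exists_const_almost (B : Subgroup A) {u u' : ColorTree A} (p : A)
    (h : (depth u' + depth u) % 2 = 0) :
    ∃ g : almost B, (g : LocalAut A) • u = u' ∧ ∀ v, (g : LocalAut A).loc v = (p, 1) := by
  obtain ⟨g, hg, hl⟩ := exists_const u u' p
  refine ⟨⟨g, ?_, parity_smul g (u := u) (by rwa [hg])⟩, hg, hl⟩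
  simp [hl, B.one_mem]

/-- Around any vertex, all neighbours are equivalent under elements without singularities. -/
theorem exists_rotation (B : Subgroup A) (m : ColorTree A) (x y : A) :
    ∃ g ∈ vertexGroup B m, (g : LocalAut A) • step y m = step x m ∧
      ∀ v, (g : LocalAut A).loc v = (x * y⁻¹, 1) := by
  obtain ⟨g, hg, hl⟩ := exists_const_almost B (u := m) (u' := m) (x * y⁻¹) (by omega)
  refine ⟨g, ⟨hg, fun v _ => by rw [hl]; exact B.one_mem⟩, ?_, hl⟩
  rw [smul_step, hg, hl]
  simp [twist]

/-- The elements that fix a given vertex and have a given local action there. -/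
theorem exists_vertexGroup_loc (B : Subgroup A) (u : ColorTree A) (s : A × A) :
    ∃ g ∈ vertexGroup B u, (g : LocalAut A).loc u = s := by
  classical
  obtain ⟨g, hg, hp, hq⟩ := exists_portrait_at u u s.1 fun v => if v = u then s.2 else 1
  have hB : ∀ v, v ≠ u → (g.loc v).2 ∈ B := fun v hv => by
    rw [hq, if_neg hv]; exact B.one_mem
  refine ⟨⟨g, mem_of_fix hg ((Set.finite_singleton u).subset fun v hv => ?_)⟩, ⟨hg, hB⟩,
    Prod.ext hp (by rw [hq, if_pos rfl])⟩
  by_contra hne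
  exact hv (hB v hne)

/-- Conjugation by elements without singularities permutes the vertex groups. -/
theorem conj_mem_vertexGroup {g k : almost B} {u : ColorTree A}
    (hg : ∀ v, ((g : LocalAut A).loc v).2 ∈ B) (hk : k ∈ vertexGroup B u) :
    g * k * g⁻¹ ∈ vertexGroup B ((g : LocalAut A) • u) := by
  have hne : ∀ v, v ≠ (g : LocalAut A) • u → (g⁻¹ : LocalAut A) • v ≠ u := fun v hv e =>
    hv (by rw [← e, smul_inv_smul])
  refine ⟨?_, fun v hv => ?_⟩
  · change ((g : LocalAut A) * k * (g : LocalAut A)⁻¹) • (g : LocalAut A) • u = _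
    rw [mul_smul, mul_smul, inv_smul_smul, hk.1]
  · exact mul_snd_mem (mul_snd_mem (hg _) (hk.2 _ (hne v hv))) (inv_snd_mem (hg _))

/-- A rotation about the parent of `v` carries `v` to its grandparent. Each such move lowers the
depth by two, so even depth leads to the root. -/
theorem exists_smul_eq_root {H : Subgroup (almost B)} (hH : ∀ u, vertexGroup B u ≤ H)
    (v : ColorTree A) (hv : depth v % 2 = 0) :
    ∃ h ∈ H, (h : LocalAut A) • v = root ∧ ∀ w, ((h : LocalAut A).loc w).2 ∈ B := by
  induction hn : depth v using Nat.strong_induction_on generalizing v with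
  | _ n ih =>
    by_cases h0 : v = root
    · exact ⟨1, H.one_mem, by rw [h0]; exact one_smul _ _, fun w => B.one_mem⟩
    obtain ⟨y, hy⟩ := exists_depth_step h0
    have hd1 := depth_step y v
    have h1 : step y v ≠ root := fun e => by
      rw [e, depth_root] at hd1
      omega
    obtain ⟨x, hx⟩ := exists_depth_step h1
    have hd2 := depth_step x (step y v)
    obtain ⟨g, hg, hgs, hgl⟩ := exists_rotation B (step y v) x y
    rw [step_step] at hgs
    obtain ⟨h, hh, hhs, hhl⟩ := ih _ (by omega) (step x (step y v)) (by omega) rfl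
    refine ⟨h * g, H.mul_mem hh (hH _ hg), ?_, fun w => mul_snd_mem (hhl _) ?_⟩
    · rw [Subgroup.coe_mul, mul_smul, hgs, hhs]
    · rw [hgl]; exact B.one_mem

/-- The vertex groups generate. -/
theorem eq_top_of_vertexGroup_le {H : Subgroup (almost B)} (hH : ∀ u, vertexGroup B u ≤ H) :
    H = ⊤ := by
  rw [Subgroup.eq_top_iff']
  intro g
  -- The induction is on the number of singularities; right multiplication by `k` below removes the
  -- one at `u` and keeps the count elsewhere.
  induction hn : {v | ((g : LocalAut A).loc v).2 ∉ B}.ncard generalizing g with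
  | zero =>
    have hB : ∀ v, ((g : LocalAut A).loc v).2 ∈ B := fun v => by
      rw [Set.ncard_eq_zero g.2.1] at hn
      by_contra hv
      exact (hn ▸ (show v ∈ {v | ((g : LocalAut A).loc v).2 ∉ B} from hv) : v ∈ (∅ : Set _))
    have hpar := g.2.2 root
    obtain ⟨h, hh, hhr, hhB⟩ := exists_smul_eq_root hH ((g : LocalAut A) • (root : ColorTree A))
      (by rw [depth_root] at hpar; omega)
    have : h * g ∈ H := hH root ⟨by rw [Subgroup.coe_mul, mul_smul, hhr],
      fun v _ => mul_snd_mem (hhB _) (hB _)⟩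
    exact (H.mul_mem_cancel_left hh).1 this
  | succ n ih =>
    obtain ⟨u, hu⟩ : {v | ((g : LocalAut A).loc v).2 ∉ B}.Nonempty := by
      rw [← Set.ncard_pos g.2.1]; omega
    obtain ⟨k, hk, hkl⟩ := exists_vertexGroup_loc B u ((g : LocalAut A).loc u)⁻¹
    have hset : {v | (((g * k : almost B) : LocalAut A).loc v).2 ∉ B} =
        ((k : LocalAut A) • ·) ⁻¹' {v | ((g : LocalAut A).loc v).2 ∉ B} \ {u} := by
      ext v
      rw [Set.mem_sdiff, Set.mem_singleton_iff, Set.mem_preimage, Set.mem_ofPred_eq,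
        Set.mem_ofPred_eq, Subgroup.coe_mul, loc_mul]
      by_cases hv : v = u
      · subst hv
        rw [hk.1, hkl, mul_inv_cancel]
        simp [B.one_mem]
      · rw [Prod.snd_mul, B.mul_mem_cancel_right (hk.2 v hv)]
        simp [hv]
    have hcard : {v | (((g * k : almost B) : LocalAut A).loc v).2 ∉ B}.ncard = n := by
      rw [hset, Set.ncard_sdiff_singleton_of_mem (by
        rw [Set.mem_preimage]
        rw [hk.1]; exact hu)]
      rw [Set.ncard_preimage_of_injective_subset_range (MulAction.injective (k : LocalAut A))
        fun v _ => MulAction.surjective (k : LocalAut A) v, hn]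
      rfl
    exact (H.mul_mem_cancel_right (hH _ hk)).1 (ih (g * k) hcard)

/-- The vertex groups of the root and of its neighbour `m` lie in `ellip B 1` up to finitely many
rotations about `m`. Nonsingular rotations then conjugate these two groups to all vertex groups. -/
theorem isCompactlyGenerated [Finite A] : IsCompactlyGeneratedGroup (almost B) := by
  let m : ColorTree A := step 1 root
  have hm : depth m = 1 := by rw [← gap_root, gap_step_self]
  choose e he hes hel using fun y : A => exists_rotation B m y 1
  refine ⟨(ellip B 1 : Set (almost B)) ∪ Set.range e,
    (isCompact_ellip 1).union (Set.finite_range e).isCompact, ?_⟩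
  set H := Subgroup.closure ((ellip B 1 : Set (almost B)) ∪ Set.range e)
  have hE : ellip B 1 ≤ H := fun g hg => Subgroup.subset_closure (Or.inl hg)
  refine eq_top_of_vertexGroup_le fun u => ?_
  have hroot : vertexGroup B root ≤ H := fun g hg => hE ⟨hg.1, fun v hv => hg.2 v (by
    rintro rfl; simp at hv)⟩
  have hM : vertexGroup B m ≤ H := fun g hg => by
    have h1 : gap m ((g : LocalAut A) • (root : ColorTree A)) = 1 := by
      have := gap_smul (g : LocalAut A) m root
      rwa [hg.1, gap_comm m root, gap_root, hm] at this
    obtain ⟨y, hy⟩ := exists_step_of_gap_eq_one h1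
    have h2 : (e y)⁻¹ * g ∈ vertexGroup B m :=
      (vertexGroup B m).mul_mem ((vertexGroup B m).inv_mem (he y)) hg
    have h3 : (e y)⁻¹ * g ∈ ellip B 1 := by
      refine ⟨?_, fun v hv => h2.2 v fun e => by rw [e] at hv; omega⟩
      rw [Subgroup.coe_mul, mul_smul, hy, Subgroup.coe_inv, inv_smul_eq_iff, ← hes]
      simp [m]
    exact (H.mul_mem_cancel_left (H.inv_mem (Subgroup.subset_closure (Or.inr ⟨y, rfl⟩)))).1 (hE h3)
  have conj : ∀ {g : almost B} {u : ColorTree A}, g ∈ H → (∀ v, ((g : LocalAut A).loc v).2 ∈ B) →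
      vertexGroup B u ≤ H → vertexGroup B ((g : LocalAut A) • u) ≤ H := by
    intro g u hgH hgB hu k hk
    have h1 := conj_mem_vertexGroup (g := g⁻¹) (fun v => inv_snd_mem (hgB _)) hk
    rw [Subgroup.coe_inv, inv_smul_smul] at h1
    have h2 := H.mul_mem (H.mul_mem hgH (hu h1)) (H.inv_mem hgH)
    convert h2 using 1
    group
  -- A vertex group is conjugated from the grandparent by a rotation in the vertex group of the
  -- parent; both are available by induction. Depth one is reached from `m` by rotating about the
  -- root.
  induction hn : depth u using Nat.strong_induction_on generalizing u with
  | _ n ih =>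
    by_cases h0 : u = root
    · rw [h0]; exact hroot
    obtain ⟨y, hy⟩ := exists_depth_step h0
    have hd1 := depth_step y u
    by_cases h1 : step y u = root
    · obtain ⟨g, hg, hgs, hgl⟩ := exists_rotation B (root : ColorTree A) y 1
      have hu : u = step y root := by rw [← h1, step_step]
      rw [hu, ← hgs]
      exact conj (hroot hg) (fun v => by rw [hgl]; exact B.one_mem) hM
    · obtain ⟨x, hx⟩ := exists_depth_step h1
      have hd2 := depth_step x (step y u)
      obtain ⟨g, hg, hgs, hgl⟩ := exists_rotation B (step y u) y x
      rw [step_step] at hgs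
      rw [← hgs]
      exact conj (ih _ (by omega) _ rfl hg) (fun v => by rw [hgl]; exact B.one_mem)
        (ih _ (by omega) _ rfl)

end LocalAut.almost

/-! ### Simplicity -/

namespace LocalAut.almost

variable {A : Type} [Group A] {B : Subgroup A}

/-- Elements without singularities that are trivial outside a half-tree. -/
def IsSupported (g : almost B) (u : ColorTree A) (x : A) : Prop :=
  (∀ v, ((g : LocalAut A).loc v).2 ∈ B) ∧ ∀ v ∉ branch u x, AgreeAt (g : LocalAut A) 1 v

theorem IsSupported.mono {g : almost B} {u : ColorTree A} {x y : A} (hxy : y ≠ x)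
    (h : IsSupported g (step x u) y) : IsSupported g u x :=
  ⟨h.1, fun v hv => h.2 v fun hm => hv (branch_subset hxy hm)⟩

theorem IsSupported.conj {g k : almost B} {u : ColorTree A} {x : A} (h : IsSupported g u x)
    (hk : ∀ v, ((k : LocalAut A).loc v).2 ∈ B) :
    IsSupported (k * g * k⁻¹) ((k : LocalAut A) • u) (twist ((k : LocalAut A).loc u) x) := by
  refine ⟨fun v => mul_snd_mem (mul_snd_mem (hk _) (h.1 _)) (inv_snd_mem (hk _)), fun v hv => ?_⟩
  have hv' : (k⁻¹ : LocalAut A) • v ∉ branch u x := by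
    rwa [← smul_mem_branch (k : LocalAut A), smul_inv_smul]
  have h1 := h.2 _ hv'
  rw [AgreeAt, one_smul, loc_one] at h1
  change AgreeAt ((k : LocalAut A) * (g : LocalAut A) * (k : LocalAut A)⁻¹) 1 v
  rw [AgreeAt, one_smul, loc_one, mul_smul, mul_smul, h1.1, smul_inv_smul, loc_mul, loc_mul,
    h1.1, h1.2, loc_inv, mul_one, mul_inv_cancel]
  exact ⟨rfl, rfl⟩

/-- A nontrivial normal subgroup contains an element that shrinks a half-tree. -/
theorem exists_shrinking (hZ : ∀ a : A, (∀ x, a * x = x * a) → a = 1)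
    (h3 : ∀ a b : A, ∃ x, x ≠ a ∧ x ≠ b) {N : Subgroup (almost B)} (hN : N.Normal)
    (hne : N ≠ ⊥) : ∃ t ∈ N, ∃ (u : ColorTree A) (x c : A), c ≠ x ∧
      ∀ v ∈ branch u x, (t : LocalAut A) • v ∈ branch (step x u) c := by
  obtain ⟨h, hh, h1⟩ := N.bot_or_exists_ne_one.resolve_left hne
  obtain ⟨u, hu⟩ : ∃ u : ColorTree A, (h : LocalAut A) • u ≠ u := by
    by_contra H
    push Not at H
    exact h1 (Subtype.ext (eq_one_of_smul hZ H))
  obtain ⟨a, ha⟩ := exists_mem_branch hu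
  obtain ⟨b, hb⟩ := exists_mem_branch hu.symm
  -- The colour `x` avoids the direction from `u` to its image and the direction that `h` turns back
  -- towards `u`; hence `h` moves the half-tree off itself.
  obtain ⟨x, hxa, hxb⟩ := h3 a (twist ((h : LocalAut A).loc u)⁻¹ b)
  have hdisj : ∀ v ∈ branch u x, (h : LocalAut A) • v ∉ branch u x := fun v hv hv' => by
    refine disjoint_branch hu.symm (fun hm => hxa (branch_unique hm ha))
      (y := twist ((h : LocalAut A).loc u) x) (fun hm => hxb ?_) hv'
      ((smul_mem_branch (h : LocalAut A)).2 hv)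
    rw [← branch_unique hm hb, twist_inv_twist]
  obtain ⟨c, hc, -⟩ := h3 x x
  obtain ⟨g, hg, hgl⟩ := exists_const_almost B (u := u) (u' := step c (step x u)) (c * x⁻¹) (by
    have h1 := depth_step x u
    have h2 := depth_step c (step x u)
    omega)
  -- `g` maps the half-tree onto the complement of `branch (step x u) c`.
  have hgT : ∀ v, (g : LocalAut A) • v ∈ branch (step c (step x u)) c ↔ v ∈ branch u x := by
    intro v
    rw [← smul_mem_branch (g : LocalAut A) (u := u) (x := x), hg, hgl]
    simp [twist]
  -- First `h` moves the half-tree into that complement; then the conjugate of `h` by `g` moves the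
  -- complement off itself, into `branch (step x u) c`.
  refine ⟨g * h * g⁻¹ * h, N.mul_mem (hN.conj_mem h hh g) hh, u, x, c, hc, fun v hv => ?_⟩
  have h1 : (h : LocalAut A) • v ∈ branch (step c (step x u)) c := by
    rw [mem_branch_step]
    exact fun hm => hdisj v hv (branch_subset hc hm)
  rw [← smul_inv_smul (g : LocalAut A) ((h : LocalAut A) • v), hgT] at h1
  have h2 := hdisj _ h1
  rw [← hgT, mem_branch_step, not_not] at h2
  exact h2

/-- Each application of `t` increases the distance from `u`, uniformly over the half-tree, and the
singularities of `t` lie within bounded distance of `u`. -/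
theorem exists_pow_smul_nonsingular {t : almost B} {u : ColorTree A} {x c : A} (hcx : c ≠ x)
    (ht : ∀ v ∈ branch u x, (t : LocalAut A) • v ∈ branch (step x u) c) :
    ∃ m, ∀ n, m ≤ n → ∀ v ∈ branch u x,
      ((t : LocalAut A).loc ((t : LocalAut A) ^ n • v)).2 ∈ B := by
  set τ : LocalAut A := (t : LocalAut A)
  have hT : ∀ v ∈ branch u x, τ • v ∈ branch u x := fun v hv => branch_subset hcx (ht v hv)
  have hpow : ∀ n : ℕ, ∀ v ∈ branch u x, τ ^ n • v ∈ branch u x := fun n => by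
    induction n with
    | zero => intro v hv; simpa using hv
    | succ n ih => intro v hv; rw [pow_succ', mul_smul]; exact hT _ (ih v hv)
  have hu : u ∉ branch (τ • u) (twist (τ.loc u) x) := fun hm => by
    have := hT _ ((smul_mem_branch τ (u := u) (v := τ⁻¹ • u) (x := x)).1 (by rwa [smul_inv_smul]))
    exact not_mem_branch_self u x (by rwa [smul_inv_smul] at this)
  -- If `u` were fixed, its neighbour `step x u` would be fixed as well, although its image lies in
  -- a half-tree not containing it.
  have hmove : 1 ≤ gap u (τ • u) := by
    by_contra h0
    have h1 : u = τ • u := eq_of_gap_eq_zero (by omega)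
    have h2 := ht _ (step_mem_branch u x)
    have h3 := gap_smul τ u (step x u)
    rw [← h1, gap_step_self] at h3
    have h4 := gap_of_mem_branch (u := u)
      (fun hm => not_mem_branch_self u x (branch_subset hcx hm)) h2
    rw [gap_step_self, h3] at h4
    have h5 : step x u = τ • step x u := eq_of_gap_eq_zero (by omega)
    rw [← h5] at h2
    exact not_mem_branch_self _ _ h2
  have hgap : ∀ n : ℕ, ∀ v ∈ branch u x, n ≤ gap u (τ ^ n • v) := fun n => by
    induction n with
    | zero => intro v _; exact Nat.zero_le _
    | succ n ih =>
      intro v hv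
      have h1 := gap_of_mem_branch hu ((smul_mem_branch τ).2 (hpow n v hv))
      rw [gap_smul] at h1
      have h2 := ih v hv
      rw [pow_succ', mul_smul]
      omega
  obtain ⟨m, hm⟩ := (t.2.1.image (gap u)).bddAbove
  refine ⟨m + 1, fun n hn v hv => ?_⟩
  by_contra hb
  have h1 := hm ⟨τ ^ n • v, hb, rfl⟩
  have h2 := hgap n v hv
  omega

/-- An infinite product of conjugates exhibits an element with small support as a commutator with
a shrinking element. -/
theorem mem_of_shrinking (hZ : ∀ a : A, (∀ x, a * x = x * a) → a = 1)
    {N : Subgroup (almost B)} (hN : N.Normal) {t : almost B} (htN : t ∈ N)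
    {u : ColorTree A} {x c e : A} (hcx : c ≠ x) (hex : e ≠ x) (hec : e ≠ c)
    (ht : ∀ v ∈ branch u x, (t : LocalAut A) • v ∈ branch (step x u) c) {m : ℕ}
    (hm : ∀ n, m ≤ n → ∀ v ∈ branch u x, ((t : LocalAut A).loc ((t : LocalAut A) ^ n • v)).2 ∈ B)
    {g : almost B} (hg : IsSupported g (((t : LocalAut A) ^ m) • step x u)
      (twist (((t : LocalAut A) ^ m).loc (step x u)) e)) : g ∈ N := by
  set τ : LocalAut A := (t : LocalAut A)
  set γ : LocalAut A := (g : LocalAut A)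
  have hT : ∀ v ∈ branch u x, τ • v ∈ branch u x := fun v hv => branch_subset hcx (ht v hv)
  have hpow : ∀ n : ℕ, ∀ v ∈ branch u x, τ ^ n • v ∈ branch u x := fun n => by
    induction n with
    | zero => intro v hv; simpa using hv
    | succ n ih => intro v hv; rw [pow_succ', mul_smul]; exact hT _ (ih v hv)
  -- The side branch of colour `e` is missed by the image of the half-tree, so its translates are
  -- disjoint. Starting at exponent `m` keeps all of them away from the singularities of `t`.
  let D : ℕ → Set (ColorTree A) := fun i => {v | ∃ w ∈ branch (step x u) e, τ ^ (m + i) • w = v}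
  let f : ℕ → LocalAut A := fun i => τ ^ i * γ * (τ ^ i)⁻¹
  have hsub : branch (step x u) e ⊆ branch u x := branch_subset hex
  have hDT : ∀ i, D i ⊆ branch u x := by
    rintro i _ ⟨w, hw, rfl⟩
    exact hpow _ _ (hsub hw)
  have hD' : ∀ i j v, i < j → v ∈ D i → v ∈ D j → False := by
    rintro i j _ hij ⟨w, hw, rfl⟩ ⟨z, hz, hwz⟩
    obtain ⟨k, rfl⟩ := Nat.exists_eq_add_of_lt hij
    rw [show m + (i + k + 1) = (m + i) + (k + 1) by ring, pow_add, mul_smul] at hwz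
    have h1 : τ ^ (k + 1) • z = w := smul_left_cancel _ hwz
    rw [pow_succ', mul_smul] at h1
    have h2 := ht _ (hpow k z (hsub hz))
    rw [h1] at h2
    exact hec (branch_unique hw h2)
  have hD : ∀ i j v, v ∈ D i → v ∈ D j → i = j := fun i j v hi hj => by
    rcases lt_trichotomy i j with h | h | h
    · exact (hD' i j v h hi hj).elim
    · exact h
    · exact (hD' j i v h hj hi).elim
  have hDsucc : ∀ i v, v ∈ D i → τ • v ∈ D (i + 1) := by
    rintro i _ ⟨w, hw, rfl⟩
    exact ⟨w, hw, by rw [← add_assoc, pow_succ', mul_smul]⟩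
  have hDpred : ∀ i v, v ∈ D (i + 1) → τ⁻¹ • v ∈ D i := by
    rintro i _ ⟨w, hw, rfl⟩
    exact ⟨w, hw, by rw [← add_assoc, pow_succ', mul_smul, inv_smul_smul]⟩
  have hfs : ∀ i, f (i + 1) = τ * f i * τ⁻¹ := fun i => by
    simp only [f, pow_succ']; group
  have hf0 : f 0 = γ := by simp [f]
  have hf : ∀ i, ∀ v ∉ D i, AgreeAt (f i) 1 v := fun i => by
    induction i with
    | zero =>
      intro v hv
      rw [hf0]
      refine hg.2 v fun hmem => hv ⟨(τ ^ m)⁻¹ • v, ?_, by simp⟩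
      rw [← smul_mem_branch (τ ^ m), smul_inv_smul]
      exact hmem
    | succ i ih =>
      intro v hv
      have h1 := ih (τ⁻¹ • v) fun h => hv (by simpa using hDsucc i _ h)
      rw [AgreeAt, one_smul, loc_one] at h1
      rw [hfs, AgreeAt, one_smul, loc_one, mul_smul, mul_smul, h1.1, smul_inv_smul, loc_mul,
        loc_mul, h1.1, h1.2, loc_inv, mul_one, mul_inv_cancel]
      exact ⟨rfl, rfl⟩
  have hmaps : ∀ i v, v ∈ D i → f i • v ∈ D i := fun i v hv => by
    by_contra hn
    have h1 := (hf i _ hn).1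
    rw [one_smul] at h1
    exact hn ((smul_left_cancel _ h1).symm ▸ hv)
  have hfB : ∀ i v, ((f i).loc v).2 ∈ B := fun i => by
    induction i with
    | zero => rw [hf0]; exact hg.1
    | succ i ih =>
      intro v
      by_cases hv : τ⁻¹ • v ∈ D i
      · have hτB : ∀ w ∈ D i, (τ.loc w).2 ∈ B := by
          rintro _ ⟨w, hw, rfl⟩
          exact hm _ (by omega) w (hsub hw)
        rw [hfs]
        refine mul_snd_mem (mul_snd_mem (hτB _ (hmaps i _ hv)) (ih _)) (inv_snd_mem (hτB _ hv))
      · rw [(hf (i + 1) v fun h => hv (hDpred i v h)).2]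
        exact B.one_mem
  -- `y` is the infinite product of the `f i`. Infinitely many factors may be nontrivial, but none
  -- has a singularity.
  obtain ⟨y, hyD, hyn⟩ := exists_glue D f hD hf
  have hyB : ∀ v, (y.loc v).2 ∈ B := fun v => by
    by_cases hv : ∃ i, v ∈ D i
    · obtain ⟨i, hi⟩ := hv
      rw [(hyD i v hi).2]; exact hfB i v
    · rw [(hyn v (by simpa using hv)).2]; exact B.one_mem
  have hyu : y • u = u := by
    rw [(hyn u fun i hi => not_mem_branch_self u x (hDT i hi)).1, one_smul]
  have hya : y ∈ almost B := mem_of_fix hyu (by simp [hyB])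
  -- Conjugation by `τ` shifts the factors by one, so only the first factor `γ` is lost.
  have key : y = γ * (τ * y * τ⁻¹) := by
    refine eq_of_smul hZ fun v => ?_
    rw [mul_smul, mul_smul, mul_smul]
    by_cases hv : ∃ i, v ∈ D i
    · obtain ⟨i, hi⟩ := hv
      rw [(hyD i v hi).1]
      cases i with
      | zero =>
        rw [(hyn (τ⁻¹ • v) fun j hj => by
          have := hD _ _ v (by simpa using hDsucc j _ hj) hi
          omega).1, one_smul, smul_inv_smul, hf0]
      | succ i =>
        rw [(hyD i _ (hDpred i v hi)).1]
        have h1 : τ • f i • τ⁻¹ • v = f (i + 1) • v := by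
          rw [hfs, mul_smul (τ * f i), mul_smul τ]
        have h2 := (hf 0 (f (i + 1) • v) fun h => by
          have := hD _ _ _ h (hmaps _ _ hi)
          omega).1
        rw [hf0, one_smul] at h2
        rw [h1, h2]
    · have hv' : ∀ i, v ∉ D i := by simpa using hv
      rw [(hyn v hv').1, (hyn (τ⁻¹ • v) fun j hj => hv' (j + 1) (by
        simpa using hDsucc j _ hj)).1, one_smul, one_smul, smul_inv_smul, ← hf0, (hf 0 v (hv' 0)).1,
        one_smul]
  let Y : almost B := ⟨y, hya⟩
  have hY : g = Y * t * Y⁻¹ * t⁻¹ := Subtype.ext (by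
    change γ = y * τ * y⁻¹ * τ⁻¹
    have h1 : γ = y * (τ * y * τ⁻¹)⁻¹ := eq_mul_inv_of_mul_eq key.symm
    rw [h1]
    group)
  rw [hY]
  exact N.mul_mem (hN.conj_mem t htN Y) (N.inv_mem htN)

/-- One half-tree comes from a shrinking element; automorphisms with constant local action transport
it to all half-trees whose base has the same parity. -/
theorem mem_of_isSupported (hZ : ∀ a : A, (∀ x, a * x = x * a) → a = 1)
    (h3 : ∀ a b : A, ∃ x, x ≠ a ∧ x ≠ b) {N : Subgroup (almost B)} (hN : N.Normal)
    (hne : N ≠ ⊥) {u : ColorTree A} {x : A} {g : almost B} (hg : IsSupported g u x) : g ∈ N := by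
  obtain ⟨u₀, x₀, h₀⟩ : ∃ (u₀ : ColorTree A) (x₀ : A),
      ∀ g : almost B, IsSupported g u₀ x₀ → g ∈ N := by
    obtain ⟨t, htN, u, x, c, hcx, ht⟩ := exists_shrinking hZ h3 hN hne
    obtain ⟨m, hm⟩ := exists_pow_smul_nonsingular hcx ht
    obtain ⟨e, hex, hec⟩ := h3 x c
    exact ⟨_, _, fun g hg => mem_of_shrinking hZ hN htN hcx hex hec ht hm hg⟩
  have key : ∀ (u₀ : ColorTree A) (x₀ : A), (∀ g : almost B, IsSupported g u₀ x₀ → g ∈ N) →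
      (depth u + depth u₀) % 2 = 0 → g ∈ N := fun u₀ x₀ h₀ hpar => by
    obtain ⟨k, hk, hkl⟩ := exists_const_almost B (u := u) (u' := u₀) (x₀ * x⁻¹) (by omega)
    have h1 := hg.conj (k := k) fun v => by rw [hkl]; exact B.one_mem
    rw [hk, hkl, show twist (x₀ * x⁻¹, 1) x = x₀ by simp [twist]] at h1
    have h2 := hN.conj_mem _ (h₀ _ h1) k⁻¹
    convert h2 using 1
    group
  by_cases hpar : (depth u + depth u₀) % 2 = 0
  · exact key u₀ x₀ h₀ hpar
  -- For the other parity, a half-tree one step further inside the good one is used.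
  · obtain ⟨y, hy, -⟩ := h3 x₀ x₀
    refine key (step x₀ u₀) y (fun g hg => h₀ g (hg.mono hy)) ?_
    have := depth_step x₀ u₀
    omega

/-- An element without singularities that fixes a vertex and its neighbours is a product of
elements supported on half-trees. -/
theorem mem_of_fix_star [Finite A] {N : Subgroup (almost B)}
    (hN : ∀ (u : ColorTree A) (x : A) (g : almost B), IsSupported g u x → g ∈ N) {u : ColorTree A}
    {g : almost B} (hB : ∀ v, ((g : LocalAut A).loc v).2 ∈ B)
    (hu : AgreeAt (g : LocalAut A) 1 u) : g ∈ N := by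
  classical
  have := Fintype.ofFinite A
  -- `F` contains the colours at `u` whose half-trees `g` may move; the restrictions of `g` to these
  -- half-trees are split off one at a time.
  have key : ∀ (F : Finset A) (g : almost B), (∀ v, ((g : LocalAut A).loc v).2 ∈ B) →
      AgreeAt (g : LocalAut A) 1 u →
      (∀ x ∉ F, ∀ v ∈ branch u x, AgreeAt (g : LocalAut A) 1 v) → g ∈ N := by
    intro F
    induction F using Finset.induction_on with
    | empty =>
      intro g _ hu hF
      have : g = 1 := Subtype.ext (ext_smul (g := (g : LocalAut A)) (h := 1) (fun v => ?_)
        fun v => ?_)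
      · rw [this]; exact N.one_mem
      all_goals
        by_cases hv : v = u
        · subst hv
          first | exact hu.1 | exact hu.2
        · obtain ⟨x, hx⟩ := exists_mem_branch hv
          have := hF x (by simp) v hx
          first | exact this.1 | exact this.2
    | insert x F hx ih =>
      intro g hB hu hF
      have hgu : (g : LocalAut A) • u = u := by rw [hu.1, one_smul]
      have hmaps : ∀ y v, (g : LocalAut A) • v ∈ branch u y ↔ v ∈ branch u y := fun y v => by
        have := smul_mem_branch (g : LocalAut A) (u := u) (v := v) (x := y)
        rwa [hgu, hu.2, loc_one, twist_one] at this
      obtain ⟨h, hh1, hh2⟩ : ∃ h : LocalAut A, (∀ v ∈ branch u x, AgreeAt h g v) ∧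
          ∀ v ∉ branch u x, AgreeAt h 1 v := by
        have hbij : Function.Bijective
            fun v => if v ∈ branch u x then (g : LocalAut A) • v else v := by
          refine ⟨fun a b hab => ?_, fun b => ?_⟩
          · simp only at hab
            split_ifs at hab with h1 h2 h2
            · exact smul_left_cancel _ hab
            · rw [← hab, hmaps] at h2; exact absurd h1 h2
            · rw [hab, hmaps] at h1; exact absurd h2 h1
            · exact hab
          · by_cases hb : b ∈ branch u x
            · refine ⟨(g : LocalAut A)⁻¹ • b, ?_⟩
              have : (g : LocalAut A)⁻¹ • b ∈ branch u x := by
                rwa [← hmaps, smul_inv_smul]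
              simp only [if_pos this, smul_inv_smul]
            · exact ⟨b, by simp only [if_neg hb]⟩
        let h : LocalAut A :=
          { toPerm := Equiv.ofBijective _ hbij
            loc := fun v => if v ∈ branch u x then (g : LocalAut A).loc v else 1
            map_step' := fun y v => by
              change (if step y v ∈ branch u x then (g : LocalAut A) • step y v else step y v) =
                step (twist (if v ∈ branch u x then (g : LocalAut A).loc v else 1) y)
                  (if v ∈ branch u x then (g : LocalAut A) • v else v)
              by_cases hv : v ∈ branch u x
              · by_cases hw : step y v ∈ branch u x
                · simp only [if_pos hv, if_pos hw, smul_step]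
                · obtain ⟨rfl, rfl⟩ := step_mem_branch_of_ne hv hw
                  simp only [if_pos hv, if_neg hw]
                  rw [← smul_step, step_step, hgu]
              · by_cases hw : step y v ∈ branch u x
                · have h1 : v = u ∧ y = x := by
                    have := step_mem_branch_of_ne hw (y := y) (by rwa [step_step])
                    refine ⟨?_, this.2⟩
                    rw [← step_step y v, this.1, this.2, step_step]
                  obtain ⟨rfl, rfl⟩ := h1
                  simp only [if_neg hv, if_pos hw]
                  rw [smul_step, hgu, hu.2, loc_one]
                · simp only [if_neg hv, if_neg hw, twist_one] }
        refine ⟨h, fun v hv => ⟨?_, ?_⟩, fun v hv => ⟨?_, ?_⟩⟩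
        · change (if v ∈ branch u x then (g : LocalAut A) • v else v) = _
          rw [if_pos hv]
        · change (if v ∈ branch u x then (g : LocalAut A).loc v else 1) = _
          rw [if_pos hv]
        · change (if v ∈ branch u x then (g : LocalAut A) • v else v) = _
          rw [if_neg hv, one_smul]
        · change (if v ∈ branch u x then (g : LocalAut A).loc v else 1) = _
          rw [if_neg hv, loc_one]
      have hhB : ∀ v, (h.loc v).2 ∈ B := fun v => by
        by_cases hv : v ∈ branch u x
        · rw [(hh1 v hv).2]; exact hB v
        · rw [(hh2 v hv).2]; exact B.one_mem
      have hhu := hh2 u (not_mem_branch_self u x)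
      let h' : almost B := ⟨h, mem_of_fix (by rw [hhu.1, one_smul]) (by simp [hhB])⟩
      have hh'N : h' ∈ N := hN u x h' ⟨hhB, hh2⟩
      have hAg : ∀ v, AgreeAt (g : LocalAut A) h v →
          AgreeAt ((h'⁻¹ * g : almost B) : LocalAut A) 1 v := fun v hv => by
        change AgreeAt (h⁻¹ * (g : LocalAut A)) 1 v
        rw [AgreeAt, mul_smul, loc_mul, hv.1, loc_inv, inv_smul_smul, hv.2, inv_mul_cancel,
          one_smul]
        exact ⟨rfl, rfl⟩
      have h1 : h'⁻¹ * g ∈ N := by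
        refine ih _ (fun v => mul_snd_mem (inv_snd_mem (hhB _)) (hB v))
          (hAg u ⟨hu.1.trans hhu.1.symm, hu.2.trans hhu.2.symm⟩) fun y hy v hv => hAg v ?_
        by_cases hyx : y = x
        · subst hyx
          exact ⟨(hh1 v hv).1.symm, (hh1 v hv).2.symm⟩
        · have h2 := hh2 v fun h => hyx (branch_unique hv h)
          have h3 := hF y (by simp [hyx, hy]) v hv
          exact ⟨h3.1.trans h2.1.symm, h3.2.trans h2.2.symm⟩
      exact (N.mul_mem_cancel_left (N.inv_mem hh'N)).1 h1
  exact key Finset.univ g hB hu fun x hx => absurd (Finset.mem_univ x) hx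

/-- The local actions at `u` realized by `N` within the vertex group form a normal subgroup `Q` of
`A × A`. Once `Q` is everything, the remaining freedom is nonsingular and trivial at `u`, hence a
product of elements supported on half-trees. -/
theorem vertexGroup_le_of_normal [Finite A] [IsSimpleGroup A]
    (hZ : ∀ a : A, (∀ x, a * x = x * a) → a = 1) (hBne : B ≠ ⊥)
    {N : Subgroup (almost B)} (hN : N.Normal)
    (hsupp : ∀ (u : ColorTree A) (x : A) (g : almost B), IsSupported g u x → g ∈ N)
    (u : ColorTree A) : vertexGroup B u ≤ N := by
  classical
  let Q : Subgroup (A × A) :=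
    { carrier := {s | ∃ n ∈ N, n ∈ vertexGroup B u ∧ (n : LocalAut A).loc u = s}
      one_mem' := ⟨1, N.one_mem, (vertexGroup B u).one_mem, rfl⟩
      mul_mem' := by
        rintro _ _ ⟨n, hn, hn', rfl⟩ ⟨k, hk, hk', rfl⟩
        exact ⟨n * k, N.mul_mem hn hk, (vertexGroup B u).mul_mem hn' hk', by
          rw [Subgroup.coe_mul, loc_mul, hk'.1]⟩
      inv_mem' := by
        rintro _ ⟨n, hn, hn', rfl⟩
        exact ⟨n⁻¹, N.inv_mem hn, (vertexGroup B u).inv_mem hn', by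
          have := ((vertexGroup B u).inv_mem hn').1
          rw [Subgroup.coe_inv] at this ⊢
          rw [loc_inv, this]⟩ }
  have hQn : ∀ s ∈ Q, ∀ r, r * s * r⁻¹ ∈ Q := by
    rintro _ ⟨n, hn, hn', rfl⟩ r
    obtain ⟨k, hk, hkl⟩ := exists_vertexGroup_loc B u r
    refine ⟨k * n * k⁻¹, hN.conj_mem n hn k, (vertexGroup B u).mul_mem
      ((vertexGroup B u).mul_mem hk hn') ((vertexGroup B u).inv_mem hk), ?_⟩
    have h1 : (k : LocalAut A)⁻¹ • u = u := by rw [inv_smul_eq_iff, hk.1]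
    change ((k : LocalAut A) * (n : LocalAut A) * (k : LocalAut A)⁻¹).loc u = _
    rw [loc_mul, loc_mul, h1, hn'.1, loc_inv, h1, hkl]
  -- This local action fixes the colour `x`, so it extends by the identity beyond that edge and
  -- becomes supported on the opposite half-tree.
  have hQb : ∀ b ∈ B, ∀ x : A, (x * b * x⁻¹, b) ∈ Q := fun b hb x => by
    obtain ⟨g, hg, hp, hq⟩ := exists_portrait_at u u (x * b * x⁻¹) fun v => if v = u then b else 1
    have hgl : g.loc u = (x * b * x⁻¹, b) := Prod.ext hp (by rw [hq, if_pos rfl])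
    have hgB : ∀ v, (g.loc v).2 ∈ B := fun v => by
      rw [hq]; split_ifs
      · exact hb
      · exact B.one_mem
    have htw : twist (g.loc u) x = x := by rw [hgl]; simp [twist]
    have h2 : (g.loc (step x u)).2 = 1 := by rw [hq, if_neg (step_ne x u)]
    have h1 : AgreeAt g 1 (step x u) := ⟨by rw [smul_step, hg, htw, one_smul], Prod.ext
      (by rw [loc_step_fst, htw, h2]; simp) h2⟩
    let g' : almost B := ⟨g, mem_of_fix hg (by simp [hgB])⟩
    refine ⟨g', hsupp (step x u) x g' ⟨hgB, fun v hv => ?_⟩, ⟨hg, fun v _ => hgB v⟩, hgl⟩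
    rw [mem_branch_step, not_not] at hv
    refine h1.branch (fun w hw => ?_) hv
    rw [hq, if_neg (by rintro rfl; exact not_mem_branch_self _ _ hw)]
    rfl
  obtain ⟨b, hb, hb1⟩ := B.bot_or_exists_ne_one.resolve_left hBne
  obtain ⟨x, hx⟩ : ∃ x, b * x ≠ x * b := by
    by_contra H
    push Not at H
    exact hb1 (hZ b H)
  have hfst : ∀ a : A, (a, (1 : A)) ∈ Q := by
    have hn : (Q.comap (MonoidHom.inl A A)).Normal := ⟨fun a ha r => by
      simpa using hQn _ ha (r, 1)⟩
    rcases hn.eq_bot_or_eq_top with h | h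
    · exfalso
      -- The second components cancel, leaving a commutator of `x` and `b` that is nontrivial by the
      -- choice of `x`.
      have h1 := Q.mul_mem (hQb b hb x) (Q.inv_mem (hQb b hb 1))
      have h2 : x * b * x⁻¹ * b⁻¹ ∈ Q.comap (MonoidHom.inl A A) := by
        simpa using h1
      rw [h, Subgroup.mem_bot, mul_inv_eq_one, mul_inv_eq_iff_eq_mul] at h2
      exact hx h2.symm
    · intro a
      exact (h ▸ Subgroup.mem_top a : a ∈ Q.comap (MonoidHom.inl A A))
  have hsnd : ∀ a : A, ((1 : A), a) ∈ Q := by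
    have hn : (Q.comap (MonoidHom.inr A A)).Normal := ⟨fun a ha r => by
      simpa using hQn _ ha (1, r)⟩
    rcases hn.eq_bot_or_eq_top with h | h
    · exfalso
      have h2 : b ∈ Q.comap (MonoidHom.inr A A) := by
        have := Q.mul_mem (hfst (b⁻¹)) (hQb b hb 1)
        simpa using this
      rw [h, Subgroup.mem_bot] at h2
      exact hb1 h2
    · intro a
      exact (h ▸ Subgroup.mem_top a : a ∈ Q.comap (MonoidHom.inr A A))
  intro g hg
  obtain ⟨n, hn, hn', hnl⟩ : (g : LocalAut A).loc u ∈ Q := by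
    have := Q.mul_mem (hfst ((g : LocalAut A).loc u).1) (hsnd ((g : LocalAut A).loc u).2)
    simpa using this
  have hfix : AgreeAt ((n⁻¹ * g : almost B) : LocalAut A) 1 u := by
    change AgreeAt ((n : LocalAut A)⁻¹ * (g : LocalAut A)) 1 u
    have h1 : (n : LocalAut A)⁻¹ • u = u := by rw [inv_smul_eq_iff, hn'.1]
    rw [AgreeAt, mul_smul, loc_mul, hg.1, h1, loc_inv, h1, hnl, inv_mul_cancel, one_smul]
    exact ⟨rfl, rfl⟩
  have hng : n⁻¹ * g ∈ vertexGroup B u :=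
    (vertexGroup B u).mul_mem ((vertexGroup B u).inv_mem hn') hg
  refine (N.mul_mem_cancel_left (N.inv_mem hn)).1 (mem_of_fix_star hsupp (fun v => ?_) hfix)
  by_cases hv : v = u
  · rw [hv, hfix.2]; exact B.one_mem
  · exact hng.2 v hv

theorem isSimpleGroup [Finite A] [IsSimpleGroup A]
    (hZ : ∀ a : A, (∀ x, a * x = x * a) → a = 1) (h3 : ∀ a b : A, ∃ x, x ≠ a ∧ x ≠ b)
    (hBne : B ≠ ⊥) : IsSimpleGroup (almost B) where
  exists_pair_ne := by
    obtain ⟨a, ha⟩ := exists_ne (1 : A)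
    obtain ⟨g, -, hg⟩ := exists_vertexGroup_loc B root (a, 1)
    refine ⟨g, 1, fun h => ha ?_⟩
    rw [h, Subgroup.coe_one, loc_one] at hg
    exact (Prod.ext_iff.1 hg).1.symm
  eq_bot_or_eq_top_of_normal N hN := by
    refine or_iff_not_imp_left.2 fun hne => eq_top_of_vertexGroup_le ?_
    exact vertexGroup_le_of_normal hZ hBne hN
      fun u x g hg => mem_of_isSupported hZ h3 hN hne hg

end LocalAut.almost

/-! ### Word metrics on locally compact groups -/

section WordLength

open scoped Pointwise

variable {G : Type} [Group G]

theorem wordLength_le_one {S : Set G} {x : G} (h : x ∈ S ∨ x⁻¹ ∈ S) : wordLength S x ≤ 1 :=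
  IsWordOfLength.wordLength_le ⟨[x], rfl, by simpa using h, by simp⟩

theorem wordLength_le_of_mem_pow {S : Set G} (hS : Subgroup.closure S = ⊤) {n : ℕ} {g : G}
    (hg : g ∈ (insert 1 (S ∪ S⁻¹)) ^ n) : wordLength S g ≤ n := by
  induction n generalizing g with
  | zero =>
    rw [pow_zero, Set.mem_one] at hg
    rw [hg, wordLength_one]
  | succ n ih =>
    rw [pow_succ] at hg
    obtain ⟨a, ha, b, hb, rfl⟩ := hg
    have h1 : wordLength S b ≤ 1 := by
      rcases hb with rfl | hb | hb
      · rw [wordLength_one]; exact Nat.zero_le _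
      · exact wordLength_le_one (Or.inl hb)
      · exact wordLength_le_one (Or.inr hb)
    exact (wordLength_mul_le hS a b).trans (Nat.add_le_add (ih ha) h1)

theorem mem_pow_of_wordLength_le {S : Set G} (hS : Subgroup.closure S = ⊤) {n : ℕ} {g : G}
    (hg : wordLength S g ≤ n) : g ∈ (insert 1 (S ∪ S⁻¹)) ^ n := by
  refine Set.pow_subset_pow_right (Set.mem_insert _ _) hg ?_
  obtain ⟨l, hl, hl', hlg⟩ := isWordOfLength_wordLength hS g
  rw [← hl]
  rw [← hlg]
  clear hg hl hlg
  induction l with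
  | nil => simp
  | cons x l ih =>
    rw [List.prod_cons, List.length_cons, pow_succ']
    refine Set.mul_mem_mul ?_ (ih fun y hy => hl' y (List.mem_cons_of_mem _ hy))
    exact Or.inr (hl' x List.mem_cons_self)

variable [TopologicalSpace G] [IsTopologicalGroup G]

theorem isCompact_pow_generators {S : Set G} (hSc : IsCompact S) (n : ℕ) :
    IsCompact ((insert 1 (S ∪ S⁻¹)) ^ n) := by
  induction n with
  | zero => rw [pow_zero]; exact isCompact_singleton
  | succ n ih => rw [pow_succ]; exact ih.mul ((hSc.union hSc.inv).insert 1)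

/-- A compact generating set of a locally compact group absorbs compact sets. -/
theorem exists_wordLength_le [T2Space G] [LocallyCompactSpace G] {S : Set G} (hSc : IsCompact S)
    (hS : Subgroup.closure S = ⊤) {K : Set G} (hK : IsCompact K) :
    ∃ n, ∀ g ∈ K, wordLength S g ≤ n := by
  -- Baire category: the balls of the word metric are compact and exhaust the group, so some ball
  -- has an interior point.
  obtain ⟨n, x, hx⟩ := nonempty_interior_of_iUnion_of_closed
    (fun n => (isCompact_pow_generators hSc n).isClosed)
    (Set.eq_univ_of_forall fun g => Set.mem_iUnion.2
      ⟨_, mem_pow_of_wordLength_le hS (le_refl (wordLength S g))⟩)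
  obtain ⟨t, ht⟩ := hK.elim_finite_subcover
    (fun g : G => (fun h => x * g⁻¹ * h) ⁻¹' interior ((insert 1 (S ∪ S⁻¹)) ^ n))
    (fun g => isOpen_interior.preimage (continuous_const_mul _))
    (fun g _ => Set.mem_iUnion.2 ⟨g, by simpa using hx⟩)
  refine ⟨t.sup (fun g => wordLength S (x * g⁻¹)⁻¹) + n, fun h hh => ?_⟩
  obtain ⟨g, hg, hgh⟩ := Set.mem_iUnion₂.1 (ht hh)
  have h1 := wordLength_mul_le hS (x * g⁻¹)⁻¹ (x * g⁻¹ * h)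
  rw [inv_mul_cancel_left] at h1
  have h2 : wordLength S (x * g⁻¹ * h) ≤ n := wordLength_le_of_mem_pow hS (interior_subset hgh)
  have h3 := Finset.le_sup (f := fun g => wordLength S (x * g⁻¹)⁻¹) hg
  omega

end WordLength

/-! ### Chains and asymptotic dimension -/

section Chains

open scoped Pointwise

variable {G : Type} [Group G]

/-- `a` and `b` can be joined by a chain in `X` whose steps are in `K`. -/
def ChainIn (X K : Set G) : G → G → Prop :=
  Relation.ReflTransGen fun a b => a ∈ X ∧ b ∈ X ∧ a⁻¹ * b ∈ K

theorem ChainIn.mono {X Y K L : Set G} (hXY : X ⊆ Y) (hKL : K ⊆ L) {a b : G}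
    (h : ChainIn X K a b) : ChainIn Y L a b := by
  induction h with
  | refl => exact Relation.ReflTransGen.refl
  | tail _ h ih => exact ih.tail ⟨hXY h.1, hXY h.2.1, hKL h.2.2⟩

theorem ChainIn.translate {X K : Set G} (g : G) {a b : G} (h : ChainIn X K a b) :
    ChainIn {x | g⁻¹ * x ∈ X} K (g * a) (g * b) := by
  induction h with
  | refl => exact Relation.ReflTransGen.refl
  | tail _ h ih =>
    exact ih.tail ⟨by simpa using h.1, by simpa using h.2.1, by simpa [mul_assoc] using h.2.2⟩

variable [TopologicalSpace G]

/-- Chains in `X` with steps in a compact set have relatively compact displacements: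
the subset `X` of the group has asymptotic dimension zero. -/
def ChainBounded (X : Set G) : Prop :=
  ∀ K : Set G, IsCompact K → ∃ C : Set G, IsCompact C ∧ ∀ a b, ChainIn X K a b → a⁻¹ * b ∈ C

theorem ChainBounded.mono {X Y : Set G} (h : ChainBounded Y) (hXY : X ⊆ Y) : ChainBounded X :=
  fun K hK => (h K hK).imp fun _ hC => ⟨hC.1, fun a b hab => hC.2 a b (hab.mono hXY le_rfl)⟩

theorem ChainBounded.translate {X : Set G} (h : ChainBounded X) (g : G) :
    ChainBounded {x | g⁻¹ * x ∈ X} := fun K hK => by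
  obtain ⟨C, hC, hC'⟩ := h K hK
  refine ⟨C, hC, fun a b hab => ?_⟩
  have := hC' _ _ ((hab.translate g⁻¹).mono (Y := X) (fun x hx => by simpa using hx) le_rfl)
  simpa [mul_assoc] using this

theorem chainBounded_empty : ChainBounded (∅ : Set G) := fun _ _ =>
  ⟨{1}, isCompact_singleton, fun a b hab => by
    cases hab with
    | refl => simp
    | tail _ h => exact absurd h.1 (Set.notMem_empty _)⟩

/-- Excursions into `Y` have displacement in a compact set `C`. Skipping them leaves a chain in `X`
with longer but still compact steps; adjoining 1 to `K` allows for absent steps. -/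
theorem ChainBounded.union [IsTopologicalGroup G] {X Y : Set G} (hX : ChainBounded X)
    (hY : ChainBounded Y) : ChainBounded (X ∪ Y) := fun K hK => by
  obtain ⟨C, hC, hCY⟩ := hY K hK
  set L := insert 1 K
  have hL : IsCompact L := hK.insert 1
  obtain ⟨D, hD, hDX⟩ := hX (K * C * L) ((hK.mul hC).mul hL)
  have h1C : (1 : G) ∈ C := by simpa using hCY 1 1 Relation.ReflTransGen.refl
  have h1L : (1 : G) ∈ L := Set.mem_insert _ _
  have hKL : K ⊆ L := Set.subset_insert _ _
  refine ⟨C ∪ (C * L * D * (L * C)), hC.union (((hC.mul hL).mul hD).mul (hL.mul hC)),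
    fun a b hab => ?_⟩
  -- `p` is the first recorded visit to `X` and `q` the latest; what follows `q` is an excursion in
  -- `Y`.
  have key : ChainIn Y K a b ∨ ∃ p q, q ∈ X ∧ a⁻¹ * p ∈ C * L ∧ ChainIn X (K * C * L) p q ∧
      (q = b ∨ ∃ q', q⁻¹ * q' ∈ K ∧ ChainIn Y K q' b) := by
    induction hab with
    | refl => exact Or.inl Relation.ReflTransGen.refl
    | @tail b c _ hbc ih =>
      obtain ⟨hb, hc, hk⟩ := hbc
      rcases ih with ih | ⟨p, q, hq, hp, hpq, ih⟩
      · by_cases hcX : c ∈ X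
        · refine Or.inr ⟨c, c, hcX, ?_, Relation.ReflTransGen.refl, Or.inl rfl⟩
          exact ⟨_, hCY _ _ ih, _, hKL hk, by group⟩
        by_cases hbY : b ∈ Y
        · exact Or.inl (ih.tail ⟨hbY, hc.resolve_left hcX, hk⟩)
        · exact Or.inr ⟨b, b, hb.resolve_right hbY, ⟨_, hCY _ _ ih, 1, h1L, mul_one _⟩,
            Relation.ReflTransGen.refl, Or.inr ⟨c, hk, Relation.ReflTransGen.refl⟩⟩
      · right
        rcases ih with rfl | ⟨q', hq', hch⟩
        · by_cases hcX : c ∈ X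
          · refine ⟨p, c, hcX, hp, hpq.tail ⟨hq, hcX, ?_⟩, Or.inl rfl⟩
            exact ⟨_, ⟨_, hk, 1, h1C, rfl⟩, 1, h1L, by simp⟩
          · exact ⟨p, q, hq, hp, hpq, Or.inr ⟨c, hk, Relation.ReflTransGen.refl⟩⟩
        · by_cases hcX : c ∈ X
          · refine ⟨p, c, hcX, hp, hpq.tail ⟨hq, hcX, ?_⟩, Or.inl rfl⟩
            exact ⟨_, ⟨_, hq', _, hCY _ _ hch, rfl⟩, _, hKL hk, by group⟩
          by_cases hbY : b ∈ Y
          · exact ⟨p, q, hq, hp, hpq, Or.inr ⟨q', hq', hch.tail ⟨hbY, hc.resolve_left hcX, hk⟩⟩⟩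
          · have hbX := hb.resolve_right hbY
            refine ⟨p, b, hbX, hp, hpq.tail ⟨hq, hbX, ?_⟩,
              Or.inr ⟨c, hk, Relation.ReflTransGen.refl⟩⟩
            exact ⟨_, ⟨_, hq', _, hCY _ _ hch, rfl⟩, 1, h1L, by group⟩
  rcases key with key | ⟨p, q, -, hp, hpq, key⟩
  · exact Or.inl (hCY _ _ key)
  · refine Or.inr ⟨_, ⟨_, hp, _, hDX _ _ hpq, rfl⟩, q⁻¹ * b, ?_, by group⟩
    rcases key with rfl | ⟨q', hq', hch⟩
    · exact ⟨1, h1L, 1, h1C, by simp⟩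
    · exact ⟨_, hKL hq', _, hCY _ _ hch, by group⟩

theorem ChainBounded.biUnion [IsTopologicalGroup G] {ι : Type} {s : Set ι} (hs : s.Finite)
    {X : ι → Set G} (hX : ∀ i ∈ s, ChainBounded (X i)) : ChainBounded (⋃ i ∈ s, X i) := by
  induction s, hs using Set.Finite.induction_on with
  | empty => simpa using chainBounded_empty
  | insert _ _ ih =>
    rw [Set.biUnion_insert]
    exact (hX _ (Set.mem_insert _ _)).union (ih fun i hi => hX i (Set.mem_insert_of_mem _ hi))

end Chains

/-! ### Asymptotic dimension in terms of chains -/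

section AsymptoticDimension

variable {G : Type} [Group G] {S : Set G}

/-- The families consist of the chain components of the sets `X i`: points of distinct components
cannot be closer than `r`, since they would be joined by one more step. -/
theorem asymptoticDimensionLE_of_chains (hS : Subgroup.closure S = ⊤) {k : ℕ}
    (h : ∀ n : ℕ, ∃ X : Fin (k + 1) → Set G, (∀ g, ∃ i, g ∈ X i) ∧ ∃ N : ℕ, ∀ i a b,
      ChainIn (X i) {g | wordLength S g ≤ n} a b → wordLength S (a⁻¹ * b) ≤ N) :
    @AsymptoticDimensionLE G (wordMetricSpace S hS).toPseudoMetricSpace k := by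
  let := wordMetricSpace S hS
  intro r _
  obtain ⟨n, hn⟩ := exists_nat_ge r
  obtain ⟨X, hX, N, hN⟩ := h n
  have hsymm : ∀ i a b, ChainIn (X i) {g | wordLength S g ≤ n} a b →
      ChainIn (X i) {g | wordLength S g ≤ n} b a := fun i a b hab => by
    induction hab with
    | refl => exact Relation.ReflTransGen.refl
    | @tail b c _ h ih =>
      refine Relation.ReflTransGen.head ⟨h.2.1, h.1, ?_⟩ ih
      have := wordLength_inv_le hS (b⁻¹ * c)
      rw [mul_inv_rev, inv_inv] at this
      exact this.trans h.2.2
  refine ⟨fun i => {A | ∃ a ∈ X i, A = {b | b ∈ X i ∧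
    ChainIn (X i) {g | wordLength S g ≤ n} a b}}, fun i => ⟨N, ?_⟩, fun i => ?_, fun g => ?_⟩
  · rintro _ ⟨a, ha, rfl⟩ x hx y hy
    exact Nat.cast_le.2 (hN i x y ((hsymm i a x hx.2).trans hy.2))
  · rintro _ ⟨a, ha, rfl⟩ _ ⟨b, hb, rfl⟩ hne x hx y hy
    by_contra hlt
    push Not at hlt
    have hxy : ChainIn (X i) {g | wordLength S g ≤ n} x y :=
      Relation.ReflTransGen.single ⟨hx.1, hy.1, by
        have : ((wordLength S (x⁻¹ * y) : ℕ) : ℝ) < r := hlt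
        exact_mod_cast (this.le.trans hn)⟩
    have hab : ChainIn (X i) {g | wordLength S g ≤ n} a b :=
      (hx.2.trans hxy).trans (hsymm i b y hy.2)
    refine hne (Set.ext fun z => and_congr_right fun _ => ⟨fun h => ?_, fun h => hab.trans h⟩)
    exact (hsymm i a b hab).trans h
  · obtain ⟨i, hi⟩ := hX g
    exact ⟨i, _, ⟨g, hi, rfl⟩, hi, Relation.ReflTransGen.refl⟩

theorem not_asymptoticDimensionLE_zero (hS : Subgroup.closure S = ⊤)
    (hunb : ∀ n, ∃ g, n < wordLength S g) :
    ¬ @AsymptoticDimensionLE G (wordMetricSpace S hS).toPseudoMetricSpace 0 := by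
  let := wordMetricSpace S hS
  intro h
  -- At scale 2 a generator, of length at most one, cannot lead from one member to another. The
  -- member containing 1 is then the whole group.
  obtain ⟨U, hb, hd, hc⟩ := h 2 two_pos
  obtain ⟨i, T, hT, h1⟩ := hc 1
  have hstep : ∀ l : List G, (∀ x ∈ l, x ∈ S ∨ x⁻¹ ∈ S) → ∀ g ∈ T, g * l.prod ∈ T := by
    intro l
    induction l with
    | nil => intro _ g hg; simpa using hg
    | cons x l ih =>
      intro hl g hg
      rw [List.prod_cons, ← mul_assoc]
      refine ih (fun y hy => hl y (List.mem_cons_of_mem _ hy)) _ ?_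
      obtain ⟨j, T', hT', hx⟩ := hc (g * x)
      have hji : j = i := Subsingleton.elim (α := Fin 1) _ _
      subst hji
      by_contra hn
      have hne : T ≠ T' := fun e => hn (e ▸ hx)
      have h2 : (2 : ℝ) ≤ (wordLength S (g⁻¹ * (g * x)) : ℕ) := hd j hT hT' hne g hg _ hx
      rw [inv_mul_cancel_left] at h2
      have h3 := wordLength_le_one (hl x List.mem_cons_self)
      have h4 : 2 ≤ wordLength S x := by exact_mod_cast h2
      omega
  obtain ⟨C, hC⟩ := hb i
  obtain ⟨n, hn⟩ := exists_nat_ge C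
  obtain ⟨g, hg⟩ := hunb n
  obtain ⟨l, -, hl, hlg⟩ := isWordOfLength_wordLength hS g
  have hgT : g ∈ T := by simpa [hlg] using hstep l hl 1 h1
  have h2 : ((wordLength S (1⁻¹ * g) : ℕ) : ℝ) ≤ C := hC T hT 1 h1 g hgT
  rw [inv_one, one_mul] at h2
  have : wordLength S g ≤ n := by exact_mod_cast h2.trans hn
  omega

theorem asymptoticDimension_eq_one {X : Type} [PseudoMetricSpace X]
    (h1 : AsymptoticDimensionLE X 1) (h0 : ¬ AsymptoticDimensionLE X 0) :
    asymptoticDimension X = 1 := by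
  refine le_antisymm (sInf_le ⟨1, by simp, h1⟩) (le_sInf ?_)
  rintro _ ⟨n, rfl, hn⟩
  have : n ≠ 0 := by rintro rfl; exact h0 hn
  exact_mod_cast Nat.one_le_iff_ne_zero.2 this

end AsymptoticDimension

/-! ### Descendants and ancestors in the rooted tree -/

namespace ColorTree

variable {Ω : Type}

/-- `v` is a descendant of `u`. -/
def Desc (u v : ColorTree Ω) : Prop := depth v = depth u + gap u v

theorem depth_le_add_gap (u v : ColorTree Ω) : depth v ≤ depth u + gap u v := by
  have := gap_triangle root u v
  rwa [gap_root, gap_root] at this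

/-- The one colour at `v` leading towards `u` is also the one leading towards the root; every other
step increases both distances. -/
theorem Desc.step {u v : ColorTree Ω} (h : Desc u v) (hne : u ≠ v) (x : Ω) :
    Desc u (step x v) := by
  obtain ⟨z, hz⟩ := exists_gap_step hne
  have h1 := depth_le_add_gap u (ColorTree.step z v)
  have h2 := depth_step z v
  have h3 := depth_step x v
  have h4 := gap_step u x v
  rw [Desc] at h ⊢
  by_cases hxz : x = z
  · subst hxz; omega
  · have h5 : ¬ gap u (ColorTree.step x v) < gap u v := fun hlt =>
      hxz (eq_of_gap_step hlt (by omega))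
    have h6 : ¬ depth (ColorTree.step x v) < depth v := fun hlt =>
      hxz (eq_of_depth_step hlt (by omega))
    omega

theorem Desc.of_gap_lt {u v w : ColorTree Ω} (h : Desc u v) (hlt : gap v w < gap u v) :
    Desc u w := by
  induction hn : gap v w generalizing w with
  | zero => rwa [← eq_of_gap_eq_zero hn]
  | succ n ih =>
    obtain ⟨x, hx⟩ := exists_gap_step (u := v) (v := w) (by rintro rfl; simp at hn)
    have h1 := ih (w := ColorTree.step x w) (by omega) (by omega)
    have h2 := h1.step (fun e => by
      rw [← e, gap_comm] at hx
      rw [gap_comm v u] at hx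
      have := gap_comm v w
      omega) x
    rwa [step_step] at h2

theorem exists_ancestor (v : ColorTree Ω) {k : ℕ} (hk : k ≤ depth v) :
    ∃ u, depth u = k ∧ Desc u v := by
  induction hn : depth v - k generalizing v with
  | zero => exact ⟨v, by omega, by simp [Desc]⟩
  | succ n ih =>
    obtain ⟨x, hx⟩ := exists_depth_step (v := v) (by rintro rfl; simp at hn)
    have h1 := depth_step x v
    obtain ⟨u, hu, hd⟩ := ih (step x v) (by omega) (by omega)
    refine ⟨u, hu, ?_⟩
    have h2 := depth_le_add_gap u v
    have h3 := gap_step u x v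
    rw [Desc] at hd ⊢
    omega

theorem exists_depth_eq (h2 : ∃ a b : Ω, a ≠ b) (n : ℕ) : ∃ v : ColorTree Ω, depth v = n := by
  induction n with
  | zero => exact ⟨root, rfl⟩
  | succ n ih =>
    obtain ⟨v, hv⟩ := ih
    obtain ⟨a, b, hab⟩ := h2
    have ha := depth_step a v
    have hb := depth_step b v
    by_cases h : depth (step a v) = depth v + 1
    · exact ⟨_, h.trans (by rw [hv])⟩
    · refine ⟨step b v, ?_⟩
      by_contra h'
      exact hab (eq_of_depth_step (v := v) (by omega) (by omega))

end ColorTree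

/-! ### Asymptotic dimension one via annuli -/

namespace LocalAut.almost

variable {A : Type} [Group A] {B : Subgroup A}

theorem gap_smul_root (g h : almost B) :
    gap ((g : LocalAut A) • (root : ColorTree A)) ((h : LocalAut A) • root) =
      depth (((g⁻¹ * h : almost B) : LocalAut A) • (root : ColorTree A)) := by
  change _ = depth (((g : LocalAut A)⁻¹ * (h : LocalAut A)) • (root : ColorTree A))
  rw [← gap_root, ← gap_smul (g : LocalAut A) root, mul_smul, smul_inv_smul]

/-- Chains that stay in annuli are confined to balls. -/
theorem exists_chain_ball {K : Set (almost B)} {R : ℕ}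
    (hR : ∀ g ∈ K, depth ((g : LocalAut A) • (root : ColorTree A)) ≤ R) (i : ℕ) (a b : almost B)
    (hab : ChainIn {g : almost B |
      depth ((g : LocalAut A) • (root : ColorTree A)) / (R + 1) % 2 = i} K a b) :
    ChainIn {g : almost B | depth (((a⁻¹ * g : almost B) : LocalAut A) • (root : ColorTree A)) ≤
      4 * (R + 1)} K a b := by
  -- `u` is the ancestor of the starting point at the inner radius of the preceding annulus;
  -- truncated subtraction makes it the root for the innermost annulus.
  obtain ⟨u, hu, hua⟩ : ∃ u, depth u =
      (depth ((a : LocalAut A) • (root : ColorTree A)) / (R + 1) - 1) * (R + 1) ∧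
      Desc u ((a : LocalAut A) • (root : ColorTree A)) := by
    refine exists_ancestor _ ((Nat.mul_le_mul_right _ (Nat.sub_le _ _)).trans ?_)
    exact Nat.div_mul_le_self _ _
  set j := depth ((a : LocalAut A) • (root : ColorTree A)) / (R + 1) with hj
  have hbound : ∀ c : almost B, depth ((c : LocalAut A) • (root : ColorTree A)) / (R + 1) = j →
      Desc u ((c : LocalAut A) • (root : ColorTree A)) →
      gap u ((c : LocalAut A) • (root : ColorTree A)) ≤ 2 * (R + 1) := fun c hc hd => by
    have h1 := Nat.lt_mul_div_succ (depth ((c : LocalAut A) • (root : ColorTree A)))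
      (Nat.succ_pos R)
    rw [Desc, hu] at hd
    rw [Nat.succ_eq_add_one, hc] at h1
    rcases Nat.eq_zero_or_pos j with h0 | h0
    · rw [h0] at h1 hd; simp at h1 hd; omega
    · obtain ⟨k, hk⟩ := Nat.exists_eq_add_of_lt h0
      rw [hk] at h1 hd
      simp only [zero_add, Nat.add_sub_cancel] at h1 hd
      ring_nf at h1 hd ⊢
      omega
  have hmem : ∀ c : almost B, gap u ((c : LocalAut A) • (root : ColorTree A)) ≤ 2 * (R + 1) →
      depth (((a⁻¹ * c : almost B) : LocalAut A) • (root : ColorTree A)) ≤ 4 * (R + 1) :=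
    fun c hc => by
      have h1 := hbound a rfl hua
      have h2 := gap_triangle ((a : LocalAut A) • (root : ColorTree A)) u ((c : LocalAut A) • root)
      rw [gap_comm _ u] at h2
      rw [← gap_smul_root]
      omega
  have key : ChainIn {g : almost B | depth (((a⁻¹ * g : almost B) : LocalAut A) •
      (root : ColorTree A)) ≤ 4 * (R + 1)} K a b ∧
      depth ((b : LocalAut A) • (root : ColorTree A)) / (R + 1) = j ∧
      Desc u ((b : LocalAut A) • (root : ColorTree A)) := by
    induction hab with
    | refl => exact ⟨Relation.ReflTransGen.refl, rfl, hua⟩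
    | @tail b c _ hbc ih =>
      obtain ⟨ih1, ih2, ih3⟩ := ih
      obtain ⟨hb, hc, hk⟩ := hbc
      rw [Set.mem_ofPred_eq] at hb hc
      have hgap : gap ((b : LocalAut A) • (root : ColorTree A)) ((c : LocalAut A) • root) ≤ R := by
        rw [gap_smul_root]; exact hR _ hk
      have h1 := depth_le_add_gap ((b : LocalAut A) • (root : ColorTree A))
        ((c : LocalAut A) • root)
      have h2 := depth_le_add_gap ((c : LocalAut A) • (root : ColorTree A))
        ((b : LocalAut A) • root)
      rw [gap_comm] at h2
      have hle1 : depth ((c : LocalAut A) • (root : ColorTree A)) / (R + 1) ≤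
          depth ((b : LocalAut A) • (root : ColorTree A)) / (R + 1) + 1 := by
        rw [← Nat.add_div_right _ (Nat.succ_pos R)]
        exact Nat.div_le_div_right (by omega)
      have hle2 : depth ((b : LocalAut A) • (root : ColorTree A)) / (R + 1) ≤
          depth ((c : LocalAut A) • (root : ColorTree A)) / (R + 1) + 1 := by
        rw [← Nat.add_div_right _ (Nat.succ_pos R)]
        exact Nat.div_le_div_right (by omega)
      -- A step changes the annulus index by at most one, and its parity is fixed along the chain.
      have hcj : depth ((c : LocalAut A) • (root : ColorTree A)) / (R + 1) = j := by
        rw [← ih2]; omega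
      have hcd : Desc u ((c : LocalAut A) • (root : ColorTree A)) := by
        rcases Nat.eq_zero_or_pos j with h0 | h0
        · have : u = root := depth_eq_zero (by rw [hu, h0]; simp)
          rw [this, Desc, gap_root]; simp
        -- An annulus of width `R + 1` separates the current one from `u`, so a step of length at
        -- most `R` cannot leave the descendants of `u`.
        · refine ih3.of_gap_lt (hgap.trans_lt ?_)
          have h3 := Nat.div_mul_le_self (depth ((b : LocalAut A) • (root : ColorTree A))) (R + 1)
          rw [ih2] at h3
          rw [Desc, hu] at ih3
          obtain ⟨k, hk⟩ := Nat.exists_eq_add_of_lt h0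
          rw [hk] at h3 ih3
          simp only [zero_add, Nat.add_sub_cancel] at h3 ih3
          rw [Nat.add_mul] at h3
          omega
      exact ⟨ih1.tail ⟨hmem b (hbound b ih2 ih3), hmem c (hbound c hcj hcd), hk⟩, hcj, hcd⟩
  exact key.1

variable [Finite A]

/-- The part of `K` in the stabilizer lies in one compact subgroup `ellip B n`, which therefore
contains all displacements of chains. -/
theorem chainBounded_stabilizer :
    ChainBounded {g : almost B | (g : LocalAut A) • (root : ColorTree A) = root} := by
  intro K hK
  let St : Subgroup (almost B) :=
    { carrier := {g : almost B | (g : LocalAut A) • (root : ColorTree A) = root}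
      one_mem' := one_smul _ _
      mul_mem' := fun {g h} hg hh => by
        change ((g : LocalAut A) * (h : LocalAut A)) • root = root
        rw [mul_smul, hh, hg]
      inv_mem' := fun {g} hg => smul_root_of_inv hg }
  have hSt : IsClosed (St : Set (almost B)) := by
    refine Subgroup.isClosed_of_isOpen _ (Subgroup.isOpen_mono (fun g hg => ?_) (isOpen_level 0))
    exact hg.1
  obtain ⟨n, hn⟩ := exists_subset_ellip (hK.inter_right hSt) fun g hg => hg.2
  refine ⟨ellip B n, isCompact_ellip n, fun a b hab => ?_⟩
  induction hab with
  | refl => rw [inv_mul_cancel]; exact (ellip B n).one_mem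
  | @tail b c _ hbc ih =>
    have h1 : b⁻¹ * c ∈ ellip B n := hn ⟨hbc.2.2, St.mul_mem (St.inv_mem hbc.1) hbc.2.1⟩
    have h2 := (ellip B n).mul_mem ih h1
    rwa [mul_assoc, mul_inv_cancel_left] at h2

/-- The set is a finite union of cosets of the root stabilizer, one for each vertex of the ball in
the orbit of the root. -/
theorem chainBounded_ball (D : ℕ) :
    ChainBounded {g : almost B | depth ((g : LocalAut A) • (root : ColorTree A)) ≤ D} := by
  refine (ChainBounded.biUnion (finite_depth_le (Ω := A) D)
    (X := fun w => {g : almost B | (g : LocalAut A) • (root : ColorTree A) = w})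
    fun w _ => ?_).mono fun g hg => Set.mem_iUnion₂.2 ⟨_, hg, rfl⟩
  by_cases hw : ∃ g : almost B, (g : LocalAut A) • (root : ColorTree A) = w
  · obtain ⟨g, rfl⟩ := hw
    refine (chainBounded_stabilizer.translate g).mono fun h hh => ?_
    change ((g : LocalAut A)⁻¹ * (h : LocalAut A)) • root = root
    rw [mul_smul, inv_smul_eq_iff]
    exact hh
  · exact chainBounded_empty.mono fun h hh => hw ⟨h, hh⟩

theorem hasAsymptoticDimension_one (h2 : ∃ a b : A, a ≠ b) :
    HasAsymptoticDimension (almost B) 1 := by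
  refine ⟨isCompactlyGenerated, fun S hSc hS => ?_⟩
  have hK : ∀ n, IsCompact ({g | wordLength S g ≤ n} : Set (almost B)) := fun n => by
    convert isCompact_pow_generators hSc n using 1
    ext g
    exact ⟨mem_pow_of_wordLength_le hS, wordLength_le_of_mem_pow hS⟩
  refine @asymptoticDimension_eq_one _ (wordMetricSpace S hS).toPseudoMetricSpace
    (asymptoticDimensionLE_of_chains hS fun n => ?_)
    (not_asymptoticDimensionLE_zero hS fun n => ?_)
  · obtain ⟨R, hR⟩ := exists_depth_smul_root_le (hK n)
    refine ⟨fun i => {g : almost B |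
      depth ((g : LocalAut A) • (root : ColorTree A)) / (R + 1) % 2 = i}, fun g => ?_, ?_⟩
    · exact ⟨⟨_, Nat.mod_lt _ two_pos⟩, rfl⟩
    · obtain ⟨C, hC, hCb⟩ := chainBounded_ball (B := B) (4 * (R + 1)) _ (hK n)
      obtain ⟨N, hN⟩ := exists_wordLength_le hSc hS hC
      refine ⟨N, fun i a b hab => hN _ ?_⟩
      have h1 := (exists_chain_ball hR i a b hab).translate a⁻¹
      have h3 := hCb _ _ (h1.mono (fun g hg => by simpa using hg) le_rfl)
      simpa using h3
  · by_contra H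
    push Not at H
    obtain ⟨R, hR⟩ := exists_depth_smul_root_le (hK n)
    -- The depth exceeds `R` and is even, so a parity-preserving element reaches it.
    obtain ⟨v, hv⟩ := exists_depth_eq h2 (2 * R + 2)
    obtain ⟨g, hg, -⟩ := exists_const_almost B (u := root) (u' := v) 1 (by
      rw [depth_root, hv]; omega)
    have := hR g (H g)
    rw [hg, hv] at this
    omega

end LocalAut.almost

/-! ### Covolume estimates -/

section Covolume

open scoped Pointwise

variable {G : Type} [Group G] [TopologicalSpace G] [IsTopologicalGroup G]

/-- Comparison of the number of cosets of an open subgroup `L` in a larger subgroup `P` with the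
number of its cosets in a fixed open subgroup `U` and the number of elements of a lattice in `P`. -/
theorem exists_card_le_of_isLattice {Γ : Subgroup G} (hΓ : IsLattice Γ) {U : Subgroup G}
    (hU : IsOpen (U : Set G)) :
    ∃ C : ℕ, ∀ (P L : Subgroup G) (α β : Type) [Finite α] [Finite β] (r : α → G) (e : G → β),
      IsOpen (L : Set G) → L ≤ P → (∀ a, r a ∈ P) → (∀ a b, (r a)⁻¹ * r b ∈ L → a = b) →
      (∀ g ∈ U, ∀ h ∈ U, e g = e h → g⁻¹ * h ∈ L) → Finite (Γ.subgroupOf P) →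
      Nat.card α ≤ C * Nat.card β * Nat.card (Γ.subgroupOf P) := by
  classical
  obtain ⟨-, hμ⟩ := hΓ
  let _ : MeasurableSpace (G ⧸ Γ) := borel (G ⧸ Γ)
  have : BorelSpace (G ⧸ Γ) := ⟨rfl⟩
  obtain ⟨μ, hμ0, hfin, hreg, hinv⟩ := hμ
  let π : G → G ⧸ Γ := QuotientGroup.mk
  have hπ : IsOpenMap π := QuotientGroup.isOpenMap_coe
  have hUpos : 0 < μ (π '' (U : Set G)) :=
    measure_isOpen_pos_of_smulInvariant_of_ne_zero G hμ0 (hπ _ hU) ⟨_, 1, U.one_mem, rfl⟩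
  obtain ⟨C, hC⟩ := ENNReal.exists_nat_mul_gt hUpos.ne' (measure_ne_top μ Set.univ)
  refine ⟨C, fun P L α β _ _ r e hL hLP hr hrL he hfinP => ?_⟩
  have := Fintype.ofFinite α
  have := Fintype.ofFinite β
  set X : Set (G ⧸ Γ) := π '' (L : Set G) with hX
  have hXo : IsOpen X := hπ _ hL
  have hsm : ∀ g : G, μ (g • X) = μ X := fun g => measure_smul μ g X
  -- `U` meets at most as many left cosets of `L` as `e` has values, and translates of `X` have
  -- equal measure.
  have hcover : μ (π '' (U : Set G)) ≤ Nat.card β * μ X := by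
    have hsub : π '' (U : Set G) ⊆
        ⋃ b : β, if h : ∃ g ∈ U, e g = b then h.choose • X else ∅ := by
      rintro _ ⟨g, hg, rfl⟩
      have h : ∃ g' ∈ U, e g' = e g := ⟨g, hg, rfl⟩
      refine Set.mem_iUnion.2 ⟨e g, ?_⟩
      rw [dif_pos h]
      have h1 := he _ h.choose_spec.1 g hg h.choose_spec.2
      exact ⟨_, ⟨_, h1, rfl⟩, by
        change π (h.choose * (h.choose⁻¹ * g)) = π g
        rw [mul_inv_cancel_left]⟩
    refine (measure_mono hsub).trans ((measure_iUnion_fintype_le μ _).trans ?_)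
    refine (Finset.sum_le_card_nsmul _ _ (μ X) fun b _ => ?_).trans ?_
    · split_ifs
      · rw [hsm]
      · simp
    · rw [Finset.card_univ, Nat.card_eq_fintype_card, nsmul_eq_mul]
  -- The translates of `X` by the `r a` may overlap, but lifts to `P` of one point differ by
  -- elements of `Γ` in `P`, which bounds the multiplicity.
  have hpack : Nat.card α * μ X ≤ Nat.card (Γ.subgroupOf P) * μ Set.univ := by
    have h1 : ∑ a : α, μ (r a • X) = Nat.card α * μ X := by
      rw [Finset.sum_congr rfl fun a _ => hsm (r a), Finset.sum_const, Finset.card_univ,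
        Nat.card_eq_fintype_card, nsmul_eq_mul]
    have hmeas : ∀ a, MeasurableSet (r a • X) := fun a => (hXo.smul (r a)).measurableSet
    have h2 : ∑ a : α, μ (r a • X) =
        ∫⁻ y, ∑ a : α, (r a • X).indicator (fun _ => (1 : ENNReal)) y ∂μ := by
      rw [lintegral_finsetSum _ fun a _ => measurable_const.indicator (hmeas a)]
      exact Finset.sum_congr rfl fun a _ => (lintegral_indicator_one (hmeas a)).symm
    have h3 : ∀ y, ∑ a : α, (r a • X).indicator (fun _ => (1 : ENNReal)) y ≤
        Nat.card (Γ.subgroupOf P) := fun y => by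
      have h4 : ∑ a : α, (r a • X).indicator (fun _ => (1 : ENNReal)) y =
          (Finset.univ.filter fun a => y ∈ r a • X).card := by
        rw [Finset.card_filter]
        push_cast
        exact Finset.sum_congr rfl fun a _ => by simp [Set.indicator_apply]
      rw [h4]
      have hpt : ∀ a : {a // y ∈ r a • X}, ∃ p ∈ P, π p = y ∧ (r a.1)⁻¹ * p ∈ L := by
        rintro ⟨a, _, ⟨l, hl, rfl⟩, hy⟩
        exact ⟨r a * l, P.mul_mem (hr a) (hLP hl), hy, by simpa using hl⟩
      choose p hpP hpy hpL using hpt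
      rw [← Fintype.card_subtype, ← Nat.card_eq_fintype_card]
      rcases isEmpty_or_nonempty {a // y ∈ r a • X} with hE | ⟨⟨a₀⟩⟩
      · rw [Nat.card_of_isEmpty]; simp
      have hΓ' : ∀ a, (p a₀)⁻¹ * p a ∈ Γ := fun a =>
        QuotientGroup.eq.1 ((hpy a₀).trans (hpy a).symm)
      let f : {a // y ∈ r a • X} → Γ.subgroupOf P := fun a =>
        ⟨⟨(p a₀)⁻¹ * p a, P.mul_mem (P.inv_mem (hpP a₀)) (hpP a)⟩, hΓ' a⟩
      have hf : Function.Injective f := fun a b hab => by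
        have h5 : (p a₀)⁻¹ * p a = (p a₀)⁻¹ * p b := congrArg (fun z => (z.1.1 : G)) hab
        have h6 : p a = p b := mul_left_cancel h5
        have h7 := L.mul_mem (hpL a) (L.inv_mem (hpL b))
        rw [h6] at h7
        exact Subtype.ext (hrL _ _ (by simpa [mul_assoc] using h7))
      exact_mod_cast Nat.card_le_card_of_injective f hf
    calc (Nat.card α : ENNReal) * μ X = ∫⁻ y, ∑ a : α, (r a • X).indicator (fun _ => 1) y ∂μ := by
          rw [← h1, h2]
      _ ≤ ∫⁻ _, (Nat.card (Γ.subgroupOf P) : ENNReal) ∂μ := lintegral_mono h3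
      _ = _ := by rw [lintegral_const]
  set m := μ (π '' (U : Set G)) with hm
  have hm_top : m ≠ ⊤ := measure_ne_top μ _
  have h1 : (Nat.card α : ENNReal) * m ≤ (C * Nat.card β * Nat.card (Γ.subgroupOf P) : ℕ) * m := by
    calc (Nat.card α : ENNReal) * m ≤ Nat.card α * (Nat.card β * μ X) := by gcongr
      _ = Nat.card β * (Nat.card α * μ X) := by ring
      _ ≤ Nat.card β * (Nat.card (Γ.subgroupOf P) * μ Set.univ) := by gcongr
      _ ≤ Nat.card β * (Nat.card (Γ.subgroupOf P) * (C * m)) := by gcongr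
      _ = _ := by push_cast; ring
  have h2 := (ENNReal.mul_le_mul_iff_left hUpos.ne' hm_top).1 h1
  exact_mod_cast h2

end Covolume

/-! ### Large subgroups of powers of a finite group -/

section Powers

open scoped commutatorElement

variable {A : Type} [Group A]

/-- Every value at the coordinate `i` is attained by an element of `H` that is trivial at the
coordinates preceding `i`. -/
def FullAt {ι : Type} (lt : ι → ι → Prop) (H : Subgroup (ι → A)) (i : ι) : Prop :=
  ∀ a, ∃ h ∈ H, h i = a ∧ ∀ j, lt j i → h j = 1

/-- The order of `H` is the product, over the coordinates, of the orders of the groups of values of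
elements trivial at all earlier coordinates. Each coordinate that is not full costs a factor `q`. -/
theorem card_mul_pow_le [Finite A] {q : ℕ}
    (hq : ∀ P : Subgroup A, P ≠ ⊤ → q * Nat.card P ≤ Nat.card A) (M : ℕ)
    (H : Subgroup (Fin M → A)) :
    Nat.card H * q ^ {i | ¬ FullAt (· < ·) H i}.ncard ≤ Nat.card A ^ M := by
  classical
  induction M with
  | zero =>
    have h0 : {i | ¬ FullAt (· < ·) H i} = ∅ := Set.eq_empty_of_isEmpty _
    rw [h0, Set.ncard_empty, pow_zero, pow_zero, mul_one]
    exact Finite.card_le_one_iff_subsingleton.2 inferInstance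
  | succ M ih =>
    let c : (Fin M → A) →* (Fin (M + 1) → A) :=
      { toFun := fun f => Fin.cons 1 f
        map_one' := by
          funext i; refine Fin.cases ?_ (fun i => ?_) i <;> simp
        map_mul' := fun f g => by
          funext i; refine Fin.cases ?_ (fun i => ?_) i <;> simp }
    let ev : H →* A := (Pi.evalMonoidHom (fun _ : Fin (M + 1) => A) 0).comp H.subtype
    have hcard : Nat.card H ≤ Nat.card (H.comap c) * Nat.card ev.range := by
      rw [← Subgroup.card_mul_index ev.ker, Subgroup.index_ker]
      refine Nat.mul_le_mul_right _ (Nat.card_le_card_of_injective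
        (fun k : ev.ker => (⟨fun i => k.1.1 i.succ, ?_⟩ : H.comap c)) fun k l hkl => ?_)
      · rw [Subgroup.mem_comap]
        convert k.1.2 using 1
        funext i
        refine Fin.cases ?_ (fun i => ?_) i
        · exact (k.2 : k.1.1 0 = 1).symm
        · simp [c]
      · refine Subtype.ext (Subtype.ext (funext fun i => ?_))
        refine Fin.cases ?_ (fun i => ?_) i
        · exact (k.2 : k.1.1 0 = 1).trans (l.2 : l.1.1 0 = 1).symm
        · exact congrFun (congrArg Subtype.val hkl) i
    have hfull : ∀ i, FullAt (· < ·) (H.comap c) i → FullAt (· < ·) H i.succ := by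
      intro i hi a
      obtain ⟨h, hh, h1, h2⟩ := hi a
      refine ⟨c h, hh, by simpa [c] using h1, fun j => ?_⟩
      refine Fin.cases ?_ (fun j hj => ?_) j
      · intro _; simp [c]
      · simpa [c] using h2 j (Fin.succ_lt_succ_iff.1 hj)
    have hsub : {i | ¬ FullAt (· < ·) H i} ⊆
        Fin.succ '' {i | ¬ FullAt (· < ·) (H.comap c) i} ∪
          {i | i = 0 ∧ ev.range ≠ ⊤} := by
      intro i
      refine Fin.cases (fun hi => Or.inr ⟨rfl, fun htop => hi fun a => ?_⟩) (fun i hi => ?_) i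
      · obtain ⟨h, hh⟩ : a ∈ ev.range := htop ▸ Subgroup.mem_top a
        exact ⟨h.1, h.2, hh, fun j hj => absurd hj (Fin.not_lt_zero j)⟩
      · exact Or.inl ⟨i, fun h => hi (hfull i h), rfl⟩
    have hn := (Set.ncard_le_ncard hsub).trans (Set.ncard_union_le _ _)
    rw [Set.ncard_image_of_injective _ (Fin.succ_injective M)] at hn
    have hq' : Nat.card ev.range * q ^ {i : Fin (M + 1) | i = 0 ∧ ev.range ≠ ⊤}.ncard ≤
        Nat.card A := by
      by_cases htop : ev.range = ⊤
      · simp [htop]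
      · have : {i : Fin (M + 1) | i = 0 ∧ ev.range ≠ ⊤} = {0} := by ext i; simp [htop]
        rw [this, Set.ncard_singleton, pow_one, mul_comm]
        exact hq _ htop
    rcases Nat.eq_zero_or_pos q with rfl | hqpos
    · by_cases hz : {i | ¬ FullAt (· < ·) H i}.ncard = 0
      · rw [hz, pow_zero, mul_one]
        refine (Nat.card_le_card_of_injective _ H.subtype_injective).trans ?_
        rw [Nat.card_fun, Nat.card_fin]
      · rw [zero_pow hz, mul_zero]; exact Nat.zero_le _
    calc _ ≤ (Nat.card (H.comap c) * Nat.card ev.range) *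
          q ^ ({i | ¬ FullAt (· < ·) (H.comap c) i}.ncard +
            {i : Fin (M + 1) | i = 0 ∧ ev.range ≠ ⊤}.ncard) :=
          Nat.mul_le_mul hcard (Nat.pow_le_pow_right hqpos hn)
      _ = (Nat.card (H.comap c) * q ^ {i | ¬ FullAt (· < ·) (H.comap c) i}.ncard) *
          (Nat.card ev.range * q ^ {i : Fin (M + 1) | i = 0 ∧ ev.range ≠ ⊤}.ncard) := by
          rw [pow_add]; ring
      _ ≤ Nat.card A ^ M * Nat.card A := Nat.mul_le_mul (ih _) hq'
      _ = _ := (pow_succ _ _).symm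

theorem card_mul_pow_le_of_equiv [Finite A] {q : ℕ}
    (hq : ∀ P : Subgroup A, P ≠ ⊤ → q * Nat.card P ≤ Nat.card A) {ι : Type} {M : ℕ}
    (e : ι ≃ Fin M) (H : Subgroup (ι → A)) :
    Nat.card H * q ^ {i | ¬ FullAt (fun j i => e j < e i) H i}.ncard ≤ Nat.card A ^ M := by
  let c : (Fin M → A) →* (ι → A) :=
    { toFun := fun f i => f (e i), map_one' := rfl, map_mul' := fun f g => rfl }
  have h1 := card_mul_pow_le hq M (H.comap c)
  have h2 : Nat.card H = Nat.card (H.comap c) := by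
    refine Nat.card_congr ⟨fun h => ⟨fun i => h.1 (e.symm i), ?_⟩, fun h => ⟨c h.1, h.2⟩,
      fun h => Subtype.ext (funext fun i => by simp [c]),
      fun h => Subtype.ext (funext fun i => by simp [c])⟩
    rw [Subgroup.mem_comap]
    convert h.2 using 1
    funext i
    simp [c]
  have h3 : {i | ¬ FullAt (fun j i => e j < e i) H i} =
      e ⁻¹' {i | ¬ FullAt (· < ·) (H.comap c) i} := by
    ext i
    refine not_congr (forall_congr' fun a => ⟨?_, ?_⟩)
    · rintro ⟨h, hh, h1, h2⟩
      refine ⟨fun i => h (e.symm i), ?_, by simpa using h1, fun j hj => h2 _ (by simpa using hj)⟩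
      rw [Subgroup.mem_comap]
      convert hh using 1
      funext i
      simp [c]
    · rintro ⟨h, hh, h1, h2⟩
      exact ⟨c h, hh, h1, fun j hj => h2 (e j) hj⟩
  rw [h2, h3, Set.ncard_preimage_of_injective_subset_range e.injective fun x _ => e.surjective x]
  exact h1

/-- A large subgroup of a power of a finite perfect group without subgroups of small index contains
one of the factors. -/
theorem exists_mulSingle_mem [Finite A] (hperf : commutator A = ⊤) {q : ℕ} (hq1 : 1 < q)
    (hq : ∀ P : Subgroup A, P ≠ ⊤ → q * Nat.card P ≤ Nat.card A) {ι : Type} [Finite ι]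
    [DecidableEq ι] (H : Subgroup (ι → A)) {c : ℕ}
    (hc : Nat.card A ^ Nat.card ι ≤ c * Nat.card H) (hc2 : c ^ 2 < q ^ Nat.card ι) :
    ∃ i, ∀ a, Pi.mulSingle i a ∈ H := by
  have hsmall : ∀ e : ι ≃ Fin (Nat.card ι),
      2 * {i | ¬ FullAt (fun j i => e j < e i) H i}.ncard < Nat.card ι := fun e => by
    have h1 := card_mul_pow_le_of_equiv hq e H
    have h2 : q ^ {i | ¬ FullAt (fun j i => e j < e i) H i}.ncard ≤ c := by
      have hpos : 0 < Nat.card H := Nat.card_pos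
      have h3 := h1.trans hc
      rw [mul_comm] at h3
      exact Nat.le_of_mul_le_mul_right h3 hpos
    by_contra hle
    push Not at hle
    have h4 := Nat.pow_le_pow_left h2 2
    rw [← pow_mul] at h4
    have h5 := Nat.pow_le_pow_right (by omega : 0 < q) hle
    rw [mul_comm 2] at h5
    omega
  let e := Finite.equivFin ι
  have h1 := hsmall e
  -- Fewer than half of the coordinates fail for each of the two opposite orders, so some coordinate
  -- is full for both.
  have h2 := hsmall (e.trans Fin.revPerm)
  obtain ⟨i, hi⟩ : ∃ i, i ∉ {i | ¬ FullAt (fun j i => e j < e i) H i} ∪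
      {i | ¬ FullAt (fun j i => e.trans Fin.revPerm j < e.trans Fin.revPerm i) H i} := by
    by_contra hn
    push Not at hn
    have h3 := Set.ncard_union_le {i | ¬ FullAt (fun j i => e j < e i) H i}
      {i | ¬ FullAt (fun j i => e.trans Fin.revPerm j < e.trans Fin.revPerm i) H i}
    rw [Set.eq_univ_of_forall hn, Set.ncard_univ] at h3
    omega
  rw [Set.mem_union, not_or, Set.mem_ofPred_eq, Set.mem_ofPred_eq, not_not, not_not] at hi
  obtain ⟨hi1, hi2⟩ := hi
  refine ⟨i, fun a => ?_⟩
  have hle : commutator A ≤ H.comap (MonoidHom.mulSingle (fun _ : ι => A) i) := by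
    rw [commutator_eq_closure, Subgroup.closure_le]
    rintro _ ⟨x, y, rfl⟩
    obtain ⟨f, hf, hfi, hfj⟩ := hi1 x
    obtain ⟨g, hg, hgi, hgj⟩ := hi2 y
    change Pi.mulSingle i ⁅x, y⁆ ∈ H
    -- `f` is trivial before `i` and `g` after it, so their commutator lives at `i` alone.
    have : (Pi.mulSingle i ⁅x, y⁆ : ι → A) = ⁅f, g⁆ := by
      funext j
      change (Pi.mulSingle i ⁅x, y⁆ : ι → A) j = f j * g j * (f j)⁻¹ * (g j)⁻¹
      rcases lt_trichotomy (e j) (e i) with h | h | h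
      · rw [Pi.mulSingle_eq_of_ne (by rintro rfl; exact lt_irrefl _ h), hfj j h]; simp
      · rw [e.injective h, Pi.mulSingle_eq_same, hfi, hgi, commutatorElement_def]
      · rw [Pi.mulSingle_eq_of_ne (by rintro rfl; exact lt_irrefl _ h),
          hgj j (by simpa using h)]
        simp
    rw [this, commutatorElement_def]
    exact H.mul_mem (H.mul_mem (H.mul_mem hf hg) (H.inv_mem hf)) (H.inv_mem hg)
  exact hle (hperf ▸ Subgroup.mem_top a)

end Powers

/-! ### Absence of lattices -/

namespace ColorTree

variable {Ω : Type} [Finite Ω]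

theorem mul_ncard_sphere_le {k : ℕ} (hk : k + 1 ≤ Nat.card Ω) (n : ℕ) :
    k * {v : ColorTree Ω | depth v = n}.ncard ≤ {v : ColorTree Ω | depth v = n + 1}.ncard := by
  classical
  have hfin : ∀ n, {v : ColorTree Ω | depth v = n}.Finite := fun n =>
    (finite_depth_le n).subset fun v hv => le_of_eq hv
  have := Fintype.ofFinite Ω
  let F : ColorTree Ω → Finset Ω := fun v => Finset.univ.filter fun x => depth (step x v) = n + 1
  have hF : ∀ v, depth v = n → k ≤ (F v).card := fun v hv => by
    have h1 : (Finset.univ.filter fun x => ¬ depth (step x v) = n + 1).card ≤ 1 := by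
      refine Finset.card_le_one.2 fun x hx y hy => ?_
      simp only [Finset.mem_filter, Finset.mem_univ, true_and] at hx hy
      have h2 := depth_step x v
      have h3 := depth_step y v
      exact eq_of_depth_step (v := v) (by omega) (by omega)
    have h2 := Finset.card_filter_add_card_filter_not (s := Finset.univ)
      (fun x : Ω => depth (step x v) = n + 1)
    rw [Finset.card_univ, ← Nat.card_eq_fintype_card] at h2
    change k ≤ (Finset.univ.filter fun x => depth (step x v) = n + 1).card
    omega
  rw [Set.ncard_eq_toFinset_card _ (hfin n), Set.ncard_eq_toFinset_card _ (hfin (n + 1)), mul_comm]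
  have h1 : ((hfin n).toFinset.sigma F).card ≤ (hfin (n + 1)).toFinset.card := by
    refine Finset.card_le_card_of_injOn (fun p => step p.2 p.1) (fun p hp => ?_) ?_
    · have := (Finset.mem_sigma.1 hp).2
      simpa [F] using this
    · rintro ⟨v, x⟩ hp ⟨w, y⟩ hq heq
      have hp' := Finset.mem_sigma.1 hp
      have hq' := Finset.mem_sigma.1 hq
      simp only [F, Set.Finite.mem_toFinset, Set.mem_ofPred_eq, Finset.mem_filter,
        Finset.mem_univ, true_and] at hp' hq' heq
      have hxy : x = y := by
        refine eq_of_depth_step (v := step x v) ?_ ?_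
        · rw [step_step]; omega
        · rw [heq, step_step]; omega
      subst hxy
      have : v = w := by rw [← step_step x v, heq, step_step]
      rw [this]
  rw [Finset.card_sigma] at h1
  exact (Finset.card_nsmul_le_sum _ _ k fun v hv => hF v (by simpa using hv)).trans h1

/-- Spheres grow at least elevenfold, so the smaller ball has at most a tenth of the size of the
next sphere. -/
theorem ball_sphere_bound (hk : 12 ≤ Nat.card Ω) (n : ℕ) :
    10 * {v : ColorTree Ω | depth v ≤ n}.ncard ≤ 11 * {v : ColorTree Ω | depth v = n}.ncard ∧
      n < ({v | depth v = n} : Set (ColorTree Ω)).ncard := by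
  induction n with
  | zero =>
    have h1 : {v : ColorTree Ω | depth v ≤ 0} = {root} := by
      ext v; exact ⟨fun h => depth_eq_zero (Nat.le_zero.1 h), fun h => by rw [h]; exact le_refl 0⟩
    have h2 : {v : ColorTree Ω | depth v = 0} = {root} := by
      ext v; exact ⟨fun h => depth_eq_zero h, fun h => by rw [h]; rfl⟩
    rw [h1, h2, Set.ncard_singleton]
    omega
  | succ n ih =>
    have h1 := mul_ncard_sphere_le (Ω := Ω) (k := 11) hk n
    have h2 : {v : ColorTree Ω | depth v ≤ n + 1} =
        {v : ColorTree Ω | depth v ≤ n} ∪ {v : ColorTree Ω | depth v = n + 1} := by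
      ext v; simp only [Set.mem_ofPred_eq, Set.mem_union]; omega
    have h3 := Set.ncard_union_le {v : ColorTree Ω | depth v ≤ n}
      {v : ColorTree Ω | depth v = n + 1}
    rw [← h2] at h3
    omega

end ColorTree

namespace LocalAut.almost

variable {A : Type} [Group A] (B : Subgroup A)

/-- The elements with trivial local action up to depth `m` and singularities at most at depth
`m + 1`. -/
def shell (m : ℕ) : Subgroup (almost B) where
  carrier := {g | (g : LocalAut A) • (root : ColorTree A) = root ∧
    (∀ v, depth v ≤ m → (g : LocalAut A).loc v = 1) ∧
    ∀ v, depth v ≠ m + 1 → ((g : LocalAut A).loc v).2 ∈ B}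
  one_mem' := ⟨one_smul _ _, fun v _ => rfl, fun v _ => B.one_mem⟩
  mul_mem' {g h} hg hh :=
    ⟨by rw [Subgroup.coe_mul, mul_smul, hh.1, hg.1], fun v hv => by
      rw [Subgroup.coe_mul, loc_mul, hh.2.1 v hv, hg.2.1 _ (by rwa [depth_smul hh.1]), mul_one],
      fun v hv => mul_snd_mem (hg.2.2 _ (by rwa [depth_smul hh.1])) (hh.2.2 _ hv)⟩
  inv_mem' {g} hg :=
    ⟨smul_root_of_inv hg.1, fun v hv => by
      rw [Subgroup.coe_inv, loc_inv, hg.2.1 _ (by rwa [depth_smul (smul_root_of_inv hg.1)]),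
        inv_one], fun v hv =>
        inv_snd_mem (hg.2.2 _ (by rwa [depth_smul (smul_root_of_inv hg.1)]))⟩

variable {B}

theorem smul_of_mem_shell {g : almost B} {m : ℕ} (hg : g ∈ shell B m) {v : ColorTree A}
    (hv : depth v = m + 1) : (g : LocalAut A) • v = v := by
  obtain ⟨x, hx⟩ := exists_depth_step (v := v) (by rintro rfl; simp at hv)
  have h1 : (g : LocalAut A) • step x v = step x v :=
    smul_of_loc_eq_one hg.1 hg.2.1 (n := m) (by omega)
  have h2 := (g : LocalAut A).smul_step x (step x v)
  rw [hg.2.1 _ (by omega), h1, twist_one, step_step] at h2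
  exact h2

variable (B) in
/-- The local actions at depth `m + 1`. -/
def shellHom (m : ℕ) : shell B m →* ({v : ColorTree A // depth v = m + 1} → A) where
  toFun g v := ((g.1 : LocalAut A).loc v.1).2
  map_one' := rfl
  map_mul' g h := funext fun v => by
    change ((g.1 : LocalAut A).loc ((h.1 : LocalAut A) • v.1) * (h.1 : LocalAut A).loc v.1).2 = _
    rw [smul_of_mem_shell h.2 v.2]
    rfl

theorem level_le_shell (m : ℕ) : level B (m + 1) ≤ shell B m := fun _ hg =>
  ⟨hg.1, fun v hv => hg.2.1 v (by omega), fun v _ => hg.2.2 v⟩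

variable [Finite A]

theorem exists_mem_shell (m : ℕ) (f : {v : ColorTree A // depth v = m + 1} → A) :
    ∃ g : shell B m, shellHom B m g = f := by
  classical
  obtain ⟨g, hg, hp, hq⟩ := exists_portrait root 1 fun v =>
    if h : depth v = m + 1 then f ⟨v, h⟩ else 1
  have hloc : ∀ v, depth v ≤ m → g.loc v = 1 := fun v hv =>
    (AgreeAt.ball (h := 1) (by rw [hg, one_smul]) hp (n := m) (fun w hw => by
      rw [hq, dif_neg (by omega)]; rfl) hv).2
  have hB : ∀ v, depth v ≠ m + 1 → (g.loc v).2 ∈ B := fun v hv => by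
    rw [hq, dif_neg hv]; exact B.one_mem
  refine ⟨⟨⟨g, mem_of_root hg ((finite_depth_le (m + 1)).subset fun v hv => ?_)⟩, hg, hloc, hB⟩,
    funext fun v => ?_⟩
  · by_contra hn
    rw [Set.mem_ofPred_eq] at hn
    exact hv (hB v (by omega))
  · change (g.loc v.1).2 = f v
    rw [hq, dif_pos v.2]

/-- A lattice would intersect the groups `shell B m` in subgroups so large that they contain
nontrivial elements without singularities close to the identity. -/
theorem not_isLattice (hB2 : Nat.card B = 2) (hperf : commutator A = ⊤)
    (h5 : ∀ P : Subgroup A, P ≠ ⊤ → 5 * Nat.card P ≤ Nat.card A) (h12 : 12 ≤ Nat.card A)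
    (Γ : Subgroup (almost B)) : ¬ IsLattice Γ := by
  classical
  intro hΓ
  obtain ⟨k, hk⟩ : ∃ k, ∀ g ∈ Γ, g ∈ level B k → g = 1 := by
    have hd := hΓ.1
    obtain ⟨U, hU, hU1⟩ := isOpen_induced_iff.1 (isOpen_discrete ({1} : Set Γ))
    have h1 : (1 : almost B) ∈ U := by
      have : (1 : Γ) ∈ Subtype.val ⁻¹' U := by rw [hU1]; rfl
      exact this
    obtain ⟨k, hk⟩ := mem_nhds_iff.1 (hU.mem_nhds h1)
    refine ⟨k, fun g hg hgk => ?_⟩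
    have h2 : (⟨g, hg⟩ : Γ) ∈ Subtype.val ⁻¹' U := by simpa using hk g hgk
    rw [hU1] at h2
    exact congrArg Subtype.val (Set.mem_singleton_iff.1 h2)
  obtain ⟨C, hC⟩ := exists_card_le_of_isLattice hΓ (isOpen_level (B := B) k)
  -- `m` is at least `k`, so nonsingular shell elements lie in `level B k`; and the sphere at depth
  -- `m + 1` has more than `C ^ 20` vertices, which absorbs `C` in the final estimate.
  set m := k + C ^ 20 with hm
  let ι := {v : ColorTree A // depth v = m + 1}
  -- Second components in this ball determine an element of `level B k` modulo `level B (m + 1)`.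
  let β := {v : ColorTree A // depth v ≤ m + 1} → B
  have hι : Finite ι := ((finite_depth_le (Ω := A) (m + 1)).subset
    fun v hv => le_of_eq hv : {v : ColorTree A | depth v = m + 1}.Finite)
  have hball : Finite {v : ColorTree A // depth v ≤ m + 1} := finite_depth_le (Ω := A) (m + 1)
  have hβcard : Nat.card β = 2 ^ {v : ColorTree A | depth v ≤ m + 1}.ncard := by
    rw [Nat.card_fun, hB2, ← Nat.card_coe_set_eq]; rfl
  obtain ⟨hM1, hM2⟩ := ball_sphere_bound (Ω := A) h12 (m + 1)
  have hιcard : Nat.card ι = {v : ColorTree A | depth v = m + 1}.ncard :=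
    Nat.card_coe_set_eq {v : ColorTree A | depth v = m + 1}
  have hsmall : ∀ γ : Γ.subgroupOf (shell B m), (∀ v, (shellHom B m γ.1 v) ∈ B) → γ = 1 := by
    intro γ hγ
    have h1 : γ.1.1 = 1 := hk _ γ.2 ⟨γ.1.2.1, fun v hv => γ.1.2.2.1 v (by omega), fun v => by
      by_cases hv : depth v = m + 1
      · exact hγ ⟨v, hv⟩
      · exact γ.1.2.2.2 v hv⟩
    exact Subtype.ext (Subtype.ext h1)
  have hinj : Function.Injective ((shellHom B m).comp (Γ.subgroupOf (shell B m)).subtype) := by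
    rw [injective_iff_map_eq_one]
    intro γ hγ
    exact hsmall γ fun v => by
      have : shellHom B m γ.1 v = 1 := congrFun hγ v
      rw [this]; exact B.one_mem
  have hfinP : Finite (Γ.subgroupOf (shell B m)) := Finite.of_injective _ hinj
  let H : Subgroup (ι → A) := (Γ.subgroupOf (shell B m)).map (shellHom B m)
  have hHcard : Nat.card (Γ.subgroupOf (shell B m)) ≤ Nat.card H :=
    Nat.card_le_card_of_injective (fun γ => (⟨shellHom B m γ.1, γ.1, γ.2, rfl⟩ : H))
      fun γ δ h => hinj (congrArg Subtype.val h)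
  choose r hr using exists_mem_shell (B := B) m
  have hcount := hC (shell B m) (level B (m + 1)) (ι → A) β (fun f => (r f).1)
    (fun g v => if h : ((g : LocalAut A).loc v.1).2 ∈ B then ⟨_, h⟩ else 1)
    (isOpen_level _) (level_le_shell m) (fun f => (r f).2)
    (fun f f' h => by
      rw [← hr f, ← hr f']
      funext v
      have h1 := h.2.1 v.1 v.2.le
      have h3 : shellHom B m ((r f)⁻¹ * r f') v = 1 := congrArg Prod.snd h1
      rw [map_mul, map_inv, Pi.mul_apply, Pi.inv_apply, inv_mul_eq_one] at h3
      exact h3)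
    (fun g hg h hh heq => by
      have hagree : ∀ v, depth v ≤ m + 1 → AgreeAt (g : LocalAut A) h v := fun v hv =>
        AgreeAt.ball (by rw [hg.1, hh.1])
          (by rw [hg.2.1 _ (Nat.zero_le _), hh.2.1 _ (Nat.zero_le _)]) (fun w hw => by
            have h1 := congrFun heq ⟨w, hw⟩
            simp only [dif_pos (hg.2.2 w), dif_pos (hh.2.2 w)] at h1
            exact congrArg Subtype.val h1) hv
      have hgi : (g : LocalAut A)⁻¹ • (root : ColorTree A) = root := smul_root_of_inv hg.1
      refine ⟨?_, fun v hv => ?_, fun v => mul_snd_mem (inv_snd_mem (hg.2.2 _)) (hh.2.2 _)⟩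
      · change ((g : LocalAut A)⁻¹ * (h : LocalAut A)) • root = root
        rw [mul_smul, hh.1, hgi]
      · change ((g : LocalAut A)⁻¹ * (h : LocalAut A)).loc v = 1
        rw [loc_mul, loc_inv, ← (hagree v hv).1, inv_smul_smul, (hagree v hv).2,
          inv_mul_cancel]) hfinP
  rw [Nat.card_fun, hβcard] at hcount
  set b := {v : ColorTree A | depth v ≤ m + 1}.ncard
  set M := {v : ColorTree A | depth v = m + 1}.ncard
  have hc2 : (C * 2 ^ b) ^ 2 < 5 ^ Nat.card ι := by
    rw [hιcard]
    -- The tenth power clears the ratio 11/10 between ball and sphere; what remains is 2 · 4 ^ 11 ≤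
    -- 5 ^ 10.
    refine lt_of_pow_lt_pow_left₀ 10 (Nat.zero_le _) ?_
    have hC20 : C ^ 20 < 2 ^ M := by
      have h1 : C ^ 20 < M := by omega
      exact h1.trans Nat.lt_two_pow_self
    calc ((C * 2 ^ b) ^ 2) ^ 10 = C ^ 20 * 4 ^ (10 * b) := by
          rw [← pow_mul, mul_pow, ← pow_mul, show (4 : ℕ) = 2 ^ 2 from rfl, ← pow_mul]
          congr 2
          ring
      _ ≤ C ^ 20 * 4 ^ (11 * M) := by gcongr; norm_num
      _ < 2 ^ M * 4 ^ (11 * M) := by gcongr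
      _ = (2 * 4 ^ 11) ^ M := by rw [mul_pow, pow_mul]
      _ ≤ (5 ^ 10) ^ M := Nat.pow_le_pow_left (by norm_num) M
      _ = (5 ^ M) ^ 10 := by rw [← pow_mul, ← pow_mul, mul_comm]
  obtain ⟨i, hi⟩ := exists_mulSingle_mem hperf (by norm_num) h5 H
    (hcount.trans (Nat.mul_le_mul_left _ hHcard)) hc2
  have hBne : B ≠ ⊥ := by
    rintro rfl
    rw [Subgroup.card_bot] at hB2
    omega
  obtain ⟨x, hx, hx1⟩ := B.bot_or_exists_ne_one.resolve_left hBne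
  obtain ⟨γ, hγ, hγx⟩ := hi x
  have h1 := hsmall ⟨γ, hγ⟩ fun v => by
    change shellHom B m γ v ∈ B
    rw [hγx]
    by_cases hv : v = i
    · rw [hv, Pi.mulSingle_eq_same]; exact hx
    · rw [Pi.mulSingle_eq_of_ne hv]; exact B.one_mem
  have h2 : γ = 1 := congrArg Subtype.val h1
  rw [h2, map_one] at hγx
  have h3 := congrFun hγx i
  rw [Pi.mulSingle_eq_same] at h3
  exact hx1 h3.symm

end LocalAut.almost

/-! ### Indices of subgroups in finite simple groups -/

section FiniteSimple

variable {A : Type} [Group A] [Finite A] [IsSimpleGroup A]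

/-- A proper subgroup of a finite simple group of order more than `4!` has index at least `5`. -/
theorem five_mul_card_le (hA : 24 < Nat.card A) (P : Subgroup A) (hP : P ≠ ⊤) :
    5 * Nat.card P ≤ Nat.card A := by
  have hcore : P.normalCore = ⊥ := by
    refine (Subgroup.Normal.eq_bot_or_eq_top inferInstance).resolve_right fun h => hP ?_
    exact top_le_iff.1 (h ▸ P.normalCore_le)
  have hinj : Function.Injective (MulAction.toPermHom A (A ⧸ P)) := by
    rw [← MonoidHom.ker_eq_bot_iff, ← Subgroup.normalCore_eq_ker, hcore]
  have h1 := Nat.card_le_card_of_injective _ hinj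
  rw [Nat.card_perm, ← Subgroup.index_eq_card] at h1
  have h2 : 5 ≤ P.index := by
    by_contra hlt
    have h3 : P.index.factorial ≤ Nat.factorial 4 := Nat.factorial_le (by omega)
    have h4 : Nat.factorial 4 = 24 := rfl
    omega
  rw [← P.card_mul_index, mul_comm]
  exact Nat.mul_le_mul_left _ h2

end FiniteSimple

theorem mainTheorem7 :
    ∃ (G : Type) (_ : Group G) (_ : TopologicalSpace G),
      IsTopologicalGroup G ∧ T2Space G ∧ LocallyCompactSpace G ∧
      IsSimpleGroup G ∧
      IsCompactlyGeneratedGroup G ∧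
      HasAsymptoticDimension G 1 ∧
      ∀ Γ : Subgroup G, ¬ IsLattice Γ := by
  let A := alternatingGroup (Fin 5)
  have hsimple : IsSimpleGroup A := alternatingGroup.isSimpleGroup (by simp)
  have hcard : Nat.card A = 60 := by
    rw [nat_card_alternatingGroup, Nat.card_fin]; rfl
  have hcenter : Subgroup.center A = ⊥ := alternatingGroup.center_eq_bot (by simp)
  have hZ : ∀ a : A, (∀ x, a * x = x * a) → a = 1 := fun a ha => by
    have : a ∈ Subgroup.center A := Subgroup.mem_center_iff.2 fun x => (ha x).symm
    rwa [hcenter, Subgroup.mem_bot] at this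
  have hperf : commutator A = ⊤ := by
    refine (Subgroup.Normal.eq_bot_or_eq_top inferInstance).resolve_left fun h => ?_
    rw [commutator_eq_bot_iff_center_eq_top, hcenter] at h
    exact bot_ne_top h
  have h3 : ∀ a b : A, ∃ x, x ≠ a ∧ x ≠ b := fun a b => by
    by_contra H
    push Not at H
    have h1 : (Set.univ : Set A) ⊆ {a, b} := fun x _ => by
      by_cases hx : x = a
      · exact Or.inl hx
      · exact Or.inr (H x hx)
    have h2 := (Set.ncard_le_ncard h1).trans (Set.ncard_insert_le a {b})
    rw [Set.ncard_univ, hcard, Set.ncard_singleton] at h2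
    omega
  -- Order two makes `B` nontrivial, as simplicity needs, yet so small that its squared order 4
  -- stays below the index bound 5, as the absence of lattices needs.
  obtain ⟨b, hb⟩ := exists_prime_orderOf_dvd_card' (G := A) 2 (by rw [hcard]; norm_num)
  let B : Subgroup A := Subgroup.zpowers b
  have hB : Nat.card B = 2 := by rw [Nat.card_zpowers, hb]
  have hBne : B ≠ ⊥ := fun h => by
    rw [h, Subgroup.card_bot] at hB
    omega
  obtain ⟨x, hx, -⟩ := h3 1 1
  exact ⟨LocalAut.almost B, inferInstance, inferInstance, inferInstance, inferInstance,
    inferInstance, LocalAut.almost.isSimpleGroup hZ h3 hBne,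
    LocalAut.almost.isCompactlyGenerated, LocalAut.almost.hasAsymptoticDimension_one ⟨x, 1, hx⟩,
    LocalAut.almost.not_isLattice hB hperf (five_mul_card_le (by omega)) (by omega)⟩
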